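/- **Setting.** Let $\mathcal H$ be a separable real Hilbert space and $\pi_0=\mathcal N(0,C)$ a centred Gaussian measure on $\mathcal H$ with injective covariance operator $C$; let $(\phi_j)_{j\ge1}$ be an orthonormal basis of $\mathcal H$ with $C\phi_j=\lambda_j^2\phi_j$, $\lambda_j>0$, and assume that for some $\kappa>\tfrac12$ $$0<\liminf_{j\to\infty}j^{\kappa}\lambda_j\le\limsup_{j\to\infty}j^{\kappa}\lambda_j<\infty .$$ For $s\ge 0$ let $\mathcal H^s=\{f\in\mathcal H:\sum_j j^{2s}\langle f,\phi_j\rangle^2<\infty\}$ with inner product $\langle f,g\rangle_s=\sum_j j^{2s}\langle f,\phi_j\rangle\langle g,\phi_j\rangle$, and let $\mathcal H^{-s}$ be its dual. Let $l\in[0,\kappa-\tfrac12)$ and let $\Phi:\mathcal H^l\to\mathbb R$ be Fréchet differentiable such that $D\Phi:\mathcal H^l\to\mathcal H^{-l}$ is globally Lipschitz and such that for every $\epsilon>0$ there is $K\in\mathbb R$ with $\Phi(q)\ge K-\epsilon\|q\|_l^2$ for all $q\in\mathcal H^l$. For $\xi\in\mathcal H^{-l}$ write $C\xi=\sum_j\lambda_j^2\,\xi(\phi_j)\phi_j\in\mathcal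 H^l$ and $\|C^{1/2}\xi\|^2=\sum_j\lambda_j^2\,\xi(\phi_j)^2$. On $\mathcal H^l\times\mathcal H^l$ let $S(q,v)=(q,-v)$ and let $\Pi$ be the probability measure with $d\Pi(q,v)\propto e^{-\Phi(q)}\,d(\pi_0\otimes\pi_0)(q,v)$ (that $\Pi$ is well defined is part of the claim). *Exact flow.* $\varphi_t$ is the flow of $\dot q=v$, $\dot v=-q-C D\Phi(q)$ on $\mathcal H^l\times\mathcal H^l$ (its global existence and uniqueness are part of the claim). *Numerical flow.* $\psi_h=\varphi^{(B)}_{h/2}\circ\varphi^{(A)}_h\circ\varphi^{(B)}_{h/2}$, where $\varphi^{(A)}_t(q,v)=(\cos t\,q+\sin t\,v,\,-\sin t\,q+\cos t\,v)$ and $\varphi^{(B)}_t(q,v)=(q,\,v-t\,C D\Phi(q))$. For $T,h>0$ with $I=T/h\in\mathbb N$ and $(q_i,v_i)=\psi_h^i(q_0,v_0)$ put $$\begin{aligned}\Delta H(q_0,v_0)={}&\Phi(q_I)-\Phi(q_0)+\tfrac{h^2}{8}\bigl(\|C^{1/2}D\Phi(q_0)\|^2-\|C^{1/2}D\Phi(q_I)\|^2\bigr)\\&-h\sum_{i=1}^{I-1}D\Phi(q_i)(v_i)-\tfrac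 h2\bigl(D\Phi(q_0)(v_0)+D\Phi(q_I)(v_I)\bigr).\end{aligned}$$ *Transition kernel.* For a proposal map $\psi$ and an acceptance probability $\alpha$, $$p(x,dy)=\alpha(x)\,\delta_{\psi(x)}(dy)+(1-\alpha(x))\,\delta_{S(x)}(dy),$$ so that the velocity is flipped in case of a rejection. For adjusted pHMC, $\psi=\psi_h^{I}$ and $\alpha=\min\{1,e^{-\Delta H}\}$; for exact pHMC, $\psi=\varphi_T$ with $T>0$, and $\alpha\equiv1$. **Proposition (Generalized Reversibility).** For adjusted pHMC (all $T,h>0$ with $T/h\in\mathbb N$) and for exact pHMC (all $T>0$), $p$ is a Markov kernel on $\mathcal H^l\times\mathcal H^l$ and satisfies generalized reversibility with respect to $\Pi$ and $S$: $$\Pi(d(q,v))\,p\bigl((q,v),d(q',v')\bigr)=\Pi(d(q',v'))\,p\bigl((q',-v'),d(q,-v)\bigr),$$ that is, $\int_A p(x,B)\,\Pi(dx)=\int_B p(S(y),S(A))\,\Pi(dy)$ for all Borel sets $A,B\subseteq\mathcal H^l\times\mathcal H^l$. -/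

import Mathlib

open MeasureTheory ProbabilityTheory Filter Topology
open scoped ENNReal NNReal InnerProductSpace

noncomputable section

namespace PHMC

/-! ### The Sobolev-like spaces `ℋˢ`, `s ≥ 0` -/

section Sobolev

variable {H : Type*} [NormedAddCommGroup H] [InnerProductSpace ℝ H]

/-- The vectors `f` of `H` with `∑ⱼ j^(2s) ⟪f, φⱼ⟫² < ∞`, as a linear subspace of `H`.
The basis is indexed by `ℕ` from `0`, so `φ j` is the vector with number `j + 1`. -/
def sobolevSubmodule (φ : HilbertBasis ℕ ℝ H) (s : ℝ) : Submodule ℝ H where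
  carrier := {f | Summable fun j : ℕ => ((j : ℝ) + 1) ^ (2 * s) * ⟪f, φ j⟫_ℝ ^ 2}
  zero_mem' := by simp [summable_zero]
  add_mem' := by
    intro f g hf hg
    refine Summable.of_nonneg_of_le (fun j => by positivity) (fun j => ?_)
      ((hf.mul_left 2).add (hg.mul_left 2))
    rw [inner_add_left]
    have hw : (0 : ℝ) ≤ ((j : ℝ) + 1) ^ (2 * s) := by positivity
    nlinarith [mul_nonneg hw (sq_nonneg (⟪f, φ j⟫_ℝ - ⟪g, φ j⟫_ℝ))]
  smul_mem' := by
    intro c f hf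
    refine (hf.mul_left (c ^ 2)).congr (fun j => ?_)
    rw [real_inner_smul_left]
    ring

/-- The space `ℋˢ` (for `s ≥ 0`): a subspace of `H`, but with its own stronger norm,
given by the inner product `⟪f, g⟫ₛ = ∑ⱼ j^(2s) ⟪f, φⱼ⟫ ⟪g, φⱼ⟫`. -/
def SobolevSpace (φ : HilbertBasis ℕ ℝ H) (s : ℝ) : Type _ := sobolevSubmodule φ s

namespace SobolevSpace

variable {φ : HilbertBasis ℕ ℝ H} {s : ℝ}

instance : AddCommGroup (SobolevSpace φ s) :=
  inferInstanceAs (AddCommGroup (sobolevSubmodule φ s))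

instance : Module ℝ (SobolevSpace φ s) :=
  inferInstanceAs (Module ℝ (sobolevSubmodule φ s))

/-- The inclusion `ℋˢ ⊆ H`. -/
def toH : SobolevSpace φ s →ₗ[ℝ] H := (sobolevSubmodule φ s).subtype

theorem toH_injective : Function.Injective (toH : SobolevSpace φ s → H) :=
  Subtype.val_injective

theorem summable_sq (f : SobolevSpace φ s) :
    Summable fun j : ℕ => ((j : ℝ) + 1) ^ (2 * s) * ⟪toH f, φ j⟫_ℝ ^ 2 := f.2

theorem summable_mul (f g : SobolevSpace φ s) :
    Summable fun j : ℕ =>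
      ((j : ℝ) + 1) ^ (2 * s) * ⟪toH f, φ j⟫_ℝ * ⟪toH g, φ j⟫_ℝ := by
  refine Summable.of_norm_bounded ((summable_sq f).add (summable_sq g)) (fun j => ?_)
  have hw : (0 : ℝ) ≤ ((j : ℝ) + 1) ^ (2 * s) := by positivity
  rw [Real.norm_eq_abs, abs_le]
  constructor
  · nlinarith [mul_nonneg hw (sq_nonneg (⟪toH f, φ j⟫_ℝ + ⟪toH g, φ j⟫_ℝ)),
      mul_nonneg hw (sq_nonneg ⟪toH f, φ j⟫_ℝ), mul_nonneg hw (sq_nonneg ⟪toH g, φ j⟫_ℝ)]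
  · nlinarith [mul_nonneg hw (sq_nonneg (⟪toH f, φ j⟫_ℝ - ⟪toH g, φ j⟫_ℝ)),
      mul_nonneg hw (sq_nonneg ⟪toH f, φ j⟫_ℝ), mul_nonneg hw (sq_nonneg ⟪toH g, φ j⟫_ℝ)]

/-- `⟪f, g⟫ₛ = ∑ⱼ j^(2s) ⟪f, φⱼ⟫ ⟪g, φⱼ⟫` is an inner product on `ℋˢ`. -/
@[reducible]
def innerCore : InnerProductSpace.Core ℝ (SobolevSpace φ s) where
  inner f g := ∑' j : ℕ, ((j : ℝ) + 1) ^ (2 * s) * ⟪toH f, φ j⟫_ℝ * ⟪toH g, φ j⟫_ℝ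
  conj_inner_symm f g := by
    simp only [conj_trivial]
    exact tsum_congr fun j => by ring
  re_inner_nonneg f := by
    simp only [RCLike.re_to_real]
    refine tsum_nonneg fun j => ?_
    have hw : (0 : ℝ) ≤ ((j : ℝ) + 1) ^ (2 * s) := by positivity
    rw [mul_assoc]
    exact mul_nonneg hw (mul_self_nonneg _)
  add_left f g k := by
    rw [← (summable_mul f k).tsum_add (summable_mul g k)]
    refine tsum_congr fun j => ?_
    rw [map_add, inner_add_left]
    ring
  smul_left f g c := by
    simp only [conj_trivial]
    rw [← tsum_mul_left]
    refine tsum_congr fun j => ?_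
    rw [map_smul, real_inner_smul_left]
    ring
  definite f hf := by
    have hnn : ∀ j : ℕ, 0 ≤ ((j : ℝ) + 1) ^ (2 * s) * ⟪toH f, φ j⟫_ℝ * ⟪toH f, φ j⟫_ℝ := by
      intro j
      rw [mul_assoc]
      exact mul_nonneg (by positivity) (mul_self_nonneg _)
    have h0 := (hasSum_zero_iff_of_nonneg hnn).1 (hf ▸ (summable_mul f f).hasSum)
    have hz : ∀ j : ℕ, ⟪toH f, φ j⟫_ℝ = 0 := by
      intro j
      have hw : (0 : ℝ) < ((j : ℝ) + 1) ^ (2 * s) := by positivity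
      have h1 := congrFun h0 j
      simp only [Pi.zero_apply, mul_assoc] at h1
      rcases mul_eq_zero.1 h1 with h2 | h2
      · exact absurd h2 hw.ne'
      · exact mul_self_eq_zero.1 h2
    apply toH_injective
    rw [map_zero]
    have hr : φ.repr (toH f) = 0 := by
      ext j
      rw [φ.repr_apply_apply, real_inner_comm, hz j]
      rfl
    simpa using hr

instance : NormedAddCommGroup (SobolevSpace φ s) :=
  @InnerProductSpace.Core.toNormedAddCommGroup ℝ _ _ _ _ innerCore

instance : InnerProductSpace ℝ (SobolevSpace φ s) :=
  InnerProductSpace.ofCore innerCore.toCore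

theorem inner_def (f g : SobolevSpace φ s) :
    ⟪f, g⟫_ℝ = ∑' j : ℕ, ((j : ℝ) + 1) ^ (2 * s) * ⟪toH f, φ j⟫_ℝ * ⟪toH g, φ j⟫_ℝ := rfl

instance : MeasurableSpace (SobolevSpace φ s) := borel _

instance : BorelSpace (SobolevSpace φ s) := ⟨rfl⟩

variable (φ s) in
/-- The basis vector `φⱼ` as an element of `ℋˢ`. -/
def basisVec (j : ℕ) : SobolevSpace φ s :=
  ⟨φ j, by
    refine summable_of_hasFiniteSupport ((Set.finite_singleton j).subset fun i hi => ?_)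
    by_contra hne
    have hij : j ≠ i := fun h => hne h.symm
    exact hi (by simp [φ.orthonormal.inner_eq_zero hij])⟩

end SobolevSpace

end Sobolev

/-! ### Preconditioned Hamiltonian Monte Carlo -/

section Dynamics

variable {H : Type*} [NormedAddCommGroup H] [InnerProductSpace ℝ H]
variable {φ : HilbertBasis ℕ ℝ H} {l : ℝ}

/-- `C ξ = ∑ⱼ λⱼ² ξ(φⱼ) φⱼ`, with the sum taken in `ℋˡ`, for `ξ` in `ℋ⁻ˡ`, the dual of `ℋˡ`:
the operator with `C φⱼ = λⱼ² φⱼ`, extended to the dual space. -/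
def applyC (lam : ℕ → ℝ) (ξ : SobolevSpace φ l →L[ℝ] ℝ) : SobolevSpace φ l :=
  ∑' j : ℕ, (lam j ^ 2 * ξ (SobolevSpace.basisVec φ l j)) • SobolevSpace.basisVec φ l j

/-- `‖C^(1/2) ξ‖²`, the norm being that of `H`, for `ξ` in `ℋ⁻ˡ`. -/
def sqNormSqrtC (lam : ℕ → ℝ) (ξ : SobolevSpace φ l →L[ℝ] ℝ) : ℝ :=
  ∑' j : ℕ, (lam j * ξ (SobolevSpace.basisVec φ l j)) ^ 2

/-- The vector field of the preconditioned Hamiltonian system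
`dq/dt = v`, `dv/dt = -q - C DΦ(q)`. -/
def hamiltonianField (lam : ℕ → ℝ) (Φ : SobolevSpace φ l → ℝ)
    (x : SobolevSpace φ l × SobolevSpace φ l) : SobolevSpace φ l × SobolevSpace φ l :=
  (x.2, -x.1 - applyC lam (fderiv ℝ Φ x.1))

/-- `flow` is the (global) flow of the preconditioned Hamiltonian system. -/
def IsExactFlow (lam : ℕ → ℝ) (Φ : SobolevSpace φ l → ℝ)
    (flow : ℝ → SobolevSpace φ l × SobolevSpace φ l → SobolevSpace φ l × SobolevSpace φ l) :
    Prop :=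
  ∀ x, flow 0 x = x ∧
    ∀ t, HasDerivAt (fun r => flow r x) (hamiltonianField lam Φ (flow t x)) t

/-- The flow of `dq/dt = v`, `dv/dt = -q`. -/
def flowA (t : ℝ) (x : SobolevSpace φ l × SobolevSpace φ l) :
    SobolevSpace φ l × SobolevSpace φ l :=
  (Real.cos t • x.1 + Real.sin t • x.2, -(Real.sin t • x.1) + Real.cos t • x.2)

/-- The flow of `dq/dt = 0`, `dv/dt = -C DΦ(q)`. -/
def flowB (lam : ℕ → ℝ) (Φ : SobolevSpace φ l → ℝ) (t : ℝ)
    (x : SobolevSpace φ l × SobolevSpace φ l) : SobolevSpace φ l × SobolevSpace φ l :=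
  (x.1, x.2 - t • applyC lam (fderiv ℝ Φ x.1))

/-- One step of size `h` of the splitting integrator. -/
def integratorStep (lam : ℕ → ℝ) (Φ : SobolevSpace φ l → ℝ) (h : ℝ)
    (x : SobolevSpace φ l × SobolevSpace φ l) : SobolevSpace φ l × SobolevSpace φ l :=
  flowB lam Φ (h / 2) (flowA h (flowB lam Φ (h / 2) x))

/-- The energy error `ΔH` of `I` steps of size `h`. -/
def energyError (lam : ℕ → ℝ) (Φ : SobolevSpace φ l → ℝ) (h : ℝ) (I : ℕ)
    (x : SobolevSpace φ l × SobolevSpace φ l) : ℝ :=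
  let q : ℕ → SobolevSpace φ l := fun i => ((integratorStep lam Φ h)^[i] x).1
  let v : ℕ → SobolevSpace φ l := fun i => ((integratorStep lam Φ h)^[i] x).2
  Φ (q I) - Φ (q 0)
    + h ^ 2 / 8 * (sqNormSqrtC lam (fderiv ℝ Φ (q 0)) - sqNormSqrtC lam (fderiv ℝ Φ (q I)))
    - h * ∑ i ∈ Finset.Ico 1 I, fderiv ℝ Φ (q i) (v i)
    - h / 2 * (fderiv ℝ Φ (q 0) (v 0) + fderiv ℝ Φ (q I) (v I))

/-- The acceptance probability `α = min {1, exp (-ΔH)}`. -/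
def acceptProb (lam : ℕ → ℝ) (Φ : SobolevSpace φ l → ℝ) (h : ℝ) (I : ℕ)
    (x : SobolevSpace φ l × SobolevSpace φ l) : ℝ :=
  min 1 (Real.exp (-energyError lam Φ h I x))

/-- The velocity flip `S(q, v) = (q, -v)`. -/
def velocityFlip (x : SobolevSpace φ l × SobolevSpace φ l) :
    SobolevSpace φ l × SobolevSpace φ l := (x.1, -x.2)

/-- The transition probabilities `p(x, ·) = α(x) δ_{ψ(x)} + (1 - α(x)) δ_{S(x)}` for the proposal
map `ψ` and the acceptance probability `α` (with values in `[0, 1]`): the proposal is accepted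
with probability `α(x)`, and the velocity is flipped in case of a rejection. -/
def transition (ψ : SobolevSpace φ l × SobolevSpace φ l → SobolevSpace φ l × SobolevSpace φ l)
    (α : SobolevSpace φ l × SobolevSpace φ l → ℝ)
    (x : SobolevSpace φ l × SobolevSpace φ l) : Measure (SobolevSpace φ l × SobolevSpace φ l) :=
  ENNReal.ofReal (α x) • Measure.dirac (ψ x)
    + ENNReal.ofReal (1 - α x) • Measure.dirac (velocityFlip x)

/-- The target `Π ∝ exp(-Φ(q)) (π₀ ⊗ π₀)(dq, dv)` on `ℋˡ × ℋˡ`, normalised to mass one, where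
`π₀`, a measure on `H`, is restricted to the subspace `ℋˡ`. -/
def target [MeasurableSpace H] (π₀ : Measure H) (Φ : SobolevSpace φ l → ℝ) :
    Measure (SobolevSpace φ l × SobolevSpace φ l) :=
  ((π₀.comap SobolevSpace.toH).prod (π₀.comap SobolevSpace.toH)).tilted (fun x => -Φ x.1)

end Dynamics

/-- Generalized reversibility of the kernel `p` with respect to the measure `Q` and the
involution `S`: `Q(dx) p(x, dy) = Q(dy) p(S y, S dx)`, evaluated on measurable rectangles. -/
def IsGeneralizedReversible {X : Type*} [MeasurableSpace X] (p : Kernel X X) (Q : Measure X)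
    (S : X → X) : Prop :=
  ∀ ⦃A B : Set X⦄, MeasurableSet A → MeasurableSet B →
    ∫⁻ x in A, p x B ∂Q = ∫⁻ y in B, p (S y) (S '' A) ∂Q

end PHMC

end

/-! Generalized reversibility of a deterministic-proposal Metropolis kernel rests on two facts about
the proposal `ψ`. First, `S ∘ ψ` is an involution. Second, `ψ` transports `exp(-ΔH) Π` to `Π`, where
`ΔH ∘ S ∘ ψ = -ΔH`. A change of variables along `ψ` together with `min(1, e^{-ΔH}) = e^{-ΔH} min(1,
e^{ΔH})` then balances the accepted moves, and the rejected moves balance because `S` preserves `Π`;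
this is `isGeneralizedReversible_of_preservesWith`.

There is no Lebesgue measure to be preserved in infinite dimensions, so the reference measure is `γ
⊗ γ`, with `γ` the prior on `ℋˡ`. Since `l < κ - 1/2`, the sum `∑ⱼ j^(2l) λⱼ²` is finite; hence the
prior charges only `ℋˡ` and is there a centred Gaussian measure with covariance `C`
(`isGaussian_comap_toH`). Rotations preserve `γ ⊗ γ`. A kick shifts `v` by a vector in the range of
the covariance, so the Cameron–Martin theorem gives its density explicitly. Log-densities add under
composition (`PreservesWith.comp`), and together with the tilting by `exp(-Φ)` they sum along the
trajectory to exactly `-ΔH` (`preservesWith_target_iterate`).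

The exact flow is the limit of the integrator with `n + 1` steps of size `T / (n + 1)`. The iterates
converge pointwise, and `ΔH` tends to zero because it is essentially the trapezoidal error for
`Φ(q(T)) - Φ(q(0)) = ∫ DΦ(q) v dt`. Fatou's lemma passes these quasi-invariances to the limit and
gives invariance of `Π` (`map_eq_of_tendsto_preservesWith`); the kernel is then the case `ΔH = 0` of
the same criterion. -/

noncomputable section

namespace PHMC

/-! ### Exponential moments and shifts of centred Gaussian measures. -/

section CameronMartin

variable {E : Type*} [NormedAddCommGroup E] [NormedSpace ℝ E] [MeasurableSpace E] [BorelSpace E]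
  {γ : Measure E} [IsGaussian γ]

theorem memLp_two_dual (ξ : StrongDual ℝ E) : MemLp ξ 2 γ :=
  IsGaussian.memLp_dual γ ξ 2 (by simp)

theorem covariance_dual_eq_zero_of_variance_eq_zero (ξ η : StrongDual ℝ E)
    (h : Var[ξ; γ] = 0) : cov[ξ, η; γ] = 0 := by
  have h := ae_eq_integral_of_variance_eq_zero (memLp_two_dual ξ) h
  rw [covariance]
  refine integral_eq_zero_of_ae ?_
  filter_upwards [h] with x hx
  simp [hx]

variable [SecondCountableTopology E] [CompleteSpace E]

theorem charFunDual_of_centered (hγ : ∫ x, x ∂γ = 0) (η : StrongDual ℝ E) :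
    charFunDual γ η = Complex.exp (-(Var[η; γ] / 2 : ℝ)) := by
  rw [IsGaussian.charFunDual_eq_of_integral_eq_zero (by simpa using hγ)]
  push_cast
  ring_nf

theorem map_eq_gaussianReal_of_centered (hγ : ∫ x, x ∂γ = 0) (ξ : StrongDual ℝ E) :
    γ.map ξ = gaussianReal 0 Var[ξ; γ].toNNReal := by
  have h : HasGaussianLaw (fun x => ξ x) γ := IsGaussian.hasGaussianLaw_id.map_fun ξ
  have h' := h.map_eq_gaussianReal
  rwa [IsGaussian.integral_dual, hγ, map_zero] at h'

theorem integrable_exp_dual (hγ : ∫ x, x ∂γ = 0) (ξ : StrongDual ℝ E) :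
    Integrable (fun x => Real.exp (ξ x)) γ := by
  have h := integrable_exp_mul_gaussianReal (μ := 0) (v := Var[ξ; γ].toNNReal) 1
  rw [← map_eq_gaussianReal_of_centered hγ, integrable_map_measure (by fun_prop) (by fun_prop)] at h
  simpa [Function.comp_def] using h

theorem integral_exp_dual (hγ : ∫ x, x ∂γ = 0) (ξ : StrongDual ℝ E) :
    ∫ x, Real.exp (ξ x) ∂γ = Real.exp (Var[ξ; γ] / 2) := by
  have h := mgf_gaussianReal (map_eq_gaussianReal_of_centered hγ ξ) 1
  simpa [mgf, Real.coe_toNNReal _ (variance_nonneg _ _)] using h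

/-- The exponential moment of `ξ + i η` under a centred Gaussian measure. -/
theorem integral_exp_dual_add_mul_I (hγ : ∫ x, x ∂γ = 0) (ξ η : StrongDual ℝ E) :
    ∫ x, Complex.exp (ξ x + η x * Complex.I) ∂γ
      = Complex.exp ((Var[ξ; γ] - Var[η; γ]) / 2 + cov[ξ, η; γ] * Complex.I) := by
  -- Regression coefficient: `ζ = η - a ξ` is uncorrelated with `ξ`, hence independent of it, the
  -- pair being jointly Gaussian. If `Var[ξ] = 0`, the convention for division gives `a = 0`, which
  -- is correct since the covariance vanishes as well.
  set a : ℝ := cov[ξ, η; γ] / Var[ξ; γ] with ha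
  have haV : a * Var[ξ; γ] = cov[ξ, η; γ] := by
    by_cases h : Var[ξ; γ] = 0
    · rw [h, mul_zero, covariance_dual_eq_zero_of_variance_eq_zero ξ η h]
    · rw [ha, div_mul_cancel₀ _ h]
  set ζ : StrongDual ℝ E := η - a • ξ with hζ
  have hζ' : (ζ : E → ℝ) = ⇑η - a • ⇑ξ := by ext x; simp [hζ]
  have hcov : cov[ξ, ζ; γ] = 0 := by
    rw [hζ', covariance_sub_right (memLp_two_dual ξ) (memLp_two_dual η)
      ((memLp_two_dual ξ).const_smul a), covariance_smul_right,
      covariance_self (by fun_prop), haV, sub_self]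
  have hvar : Var[ζ; γ] = Var[η; γ] - 2 * a * cov[ξ, η; γ] + a ^ 2 * Var[ξ; γ] := by
    rw [hζ', variance_sub (memLp_two_dual η) ((memLp_two_dual ξ).const_smul a), variance_smul,
      covariance_smul_right, covariance_comm]
    ring
  have hind : IndepFun ξ ζ γ :=
    HasGaussianLaw.indepFun_of_covariance_eq_zero
      (IsGaussian.hasGaussianLaw_id.map_fun (ξ.prod ζ)) hcov
  have hind' := hind.comp (φ := fun t : ℝ => Complex.exp ((1 + a * Complex.I) * t))
    (ψ := fun t : ℝ => Complex.exp (t * Complex.I)) (by fun_prop) (by fun_prop)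
  have h1 : ∫ x, Complex.exp ((1 + a * Complex.I) * ξ x) ∂γ
      = Complex.exp (Var[ξ; γ] * (1 + a * Complex.I) ^ 2 / 2) := by
    have := complexMGF_gaussianReal (map_eq_gaussianReal_of_centered hγ ξ) (1 + a * Complex.I)
    simpa [complexMGF, Real.coe_toNNReal _ (variance_nonneg _ _)] using this
  have h2 := charFunDual_of_centered hγ ζ
  rw [charFunDual_apply] at h2
  calc ∫ x, Complex.exp (ξ x + η x * Complex.I) ∂γ
      = ∫ x, Complex.exp ((1 + a * Complex.I) * ξ x) * Complex.exp (ζ x * Complex.I) ∂γ := by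
        refine integral_congr_ae (.of_forall fun x => ?_)
        simp only [← Complex.exp_add, hζ', Pi.sub_apply, Pi.smul_apply, smul_eq_mul]
        push_cast
        ring_nf
    _ = (∫ x, Complex.exp ((1 + a * Complex.I) * ξ x) ∂γ)
          * ∫ x, Complex.exp (ζ x * Complex.I) ∂γ :=
        hind'.integral_fun_mul_eq_mul_integral
          (Measurable.aestronglyMeasurable (by fun_prop))
          (Measurable.aestronglyMeasurable (by fun_prop))
    _ = _ := by
        rw [h1, h2, ← Complex.exp_add, hvar, ← haV]
        push_cast
        congr 1
        linear_combination (a ^ 2 * Var[ξ; γ] / 2 : ℂ) * Complex.I_sq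

/-- **Cameron–Martin theorem** for a shift in the range of the covariance. -/
theorem tilted_dual_eq_map_add (hγ : ∫ x, x ∂γ = 0) (ξ : StrongDual ℝ E) (c : E)
    (hc : ∀ η : StrongDual ℝ E, cov[ξ, η; γ] = η c) :
    γ.tilted ξ = γ.map (· + c) := by
  have := isProbabilityMeasure_tilted (integrable_exp_dual hγ ξ)
  refine Measure.ext_of_charFunDual ?_
  ext η
  rw [charFunDual_apply, charFunDual_apply, integral_tilted,
    integral_map (by fun_prop) (Measurable.aestronglyMeasurable (by fun_prop)),
    integral_exp_dual hγ]
  have h1 : ∀ x, (Real.exp (ξ x) / Real.exp (Var[ξ; γ] / 2)) • Complex.exp (η x * Complex.I)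
      = Complex.exp (-(Var[ξ; γ] / 2)) * Complex.exp (ξ x + η x * Complex.I) := by
    intro x
    rw [← Real.exp_sub, Complex.real_smul, Complex.ofReal_exp, ← Complex.exp_add,
      ← Complex.exp_add]
    push_cast
    ring_nf
  have h2 : ∀ x, Complex.exp (η (x + c) * Complex.I)
      = Complex.exp (η c * Complex.I) * Complex.exp (η x * Complex.I) := by
    intro x
    rw [← Complex.exp_add, map_add]
    push_cast
    ring_nf
  simp_rw [h1, h2]
  rw [integral_const_mul, integral_const_mul, integral_exp_dual_add_mul_I hγ, ← charFunDual_apply,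
    charFunDual_of_centered hγ, ← Complex.exp_add, ← Complex.exp_add, hc]
  push_cast
  ring_nf

/-- Tilting by `ξ` moves `γ` by `c`, and subtracting `c` moves it back. The normalising constant is
explicit because `Var[ξ] = cov[ξ, ξ] = ξ c`. This is the form needed for the kick of the integrator.
-/
theorem lintegral_sub_mul_exp_dual (hγ : ∫ x, x ∂γ = 0) (ξ : StrongDual ℝ E) (c : E)
    (hc : ∀ η : StrongDual ℝ E, cov[ξ, η; γ] = η c) {g : E → ℝ≥0∞} (hg : Measurable g) :
    ∫⁻ v, g (v - c) * ENNReal.ofReal (Real.exp (ξ v - ξ c / 2)) ∂γ = ∫⁻ v, g v ∂γ := by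
  have h := congrArg (fun m : Measure E => ∫⁻ v, g (v - c) ∂m) (tilted_dual_eq_map_add hγ ξ c hc)
  rw [lintegral_map (by fun_prop) (by fun_prop), lintegral_tilted, integral_exp_dual hγ,
    ← covariance_self (by fun_prop), hc] at h
  simp only [add_sub_cancel_right] at h
  rw [← h]
  refine lintegral_congr fun v => ?_
  rw [Real.exp_sub, mul_comm]

end CameronMartin

/-! ### Global flows of Lipschitz vector fields. -/

section LipschitzODE

variable {X : Type*} [NormedAddCommGroup X] [NormedSpace ℝ X] {F : X → X} {K : ℝ≥0}

/-- Two solutions of an autonomous Lipschitz equation on an open interval agree if they agree at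
one time. -/
theorem eqOn_Ioo_of_hasDerivAt (hF : LipschitzWith K F) {x y : ℝ → X} {a b t₀ : ℝ}
    (ht₀ : t₀ ∈ Set.Ioo a b) (hx : ∀ t ∈ Set.Ioo a b, HasDerivAt x (F (x t)) t)
    (hy : ∀ t ∈ Set.Ioo a b, HasDerivAt y (F (y t)) t) (h : x t₀ = y t₀) :
    Set.EqOn x y (Set.Ioo a b) :=
  ODE_solution_unique_of_mem_Ioo (v := fun _ => F) (s := fun _ => Set.univ) (K := K)
    (fun _ _ => hF.lipschitzOnWith) ht₀ (fun t ht => ⟨hx t ht, trivial⟩)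
    (fun t ht => ⟨hy t ht, trivial⟩) h

theorem eq_of_forall_hasDerivAt (hF : LipschitzWith K F) {x y : ℝ → X} {t₀ : ℝ}
    (hx : ∀ t, HasDerivAt x (F (x t)) t) (hy : ∀ t, HasDerivAt y (F (y t)) t)
    (h : x t₀ = y t₀) : x = y :=
  ODE_solution_unique_univ (v := fun _ => F) (s := fun _ => Set.univ) (K := K)
    (fun _ => hF.lipschitzOnWith) (fun t => ⟨hx t, trivial⟩) (fun t => ⟨hy t, trivial⟩) h

/-- The existence time of Picard–Lindelöf is uniform in the initial value for a globally Lipschitz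
field. -/
theorem exists_hasDerivAt_Ioo_uniform [CompleteSpace X] (hF : LipschitzWith K F) (t₀ : ℝ) (x₀ : X) :
    ∃ x : ℝ → X, x t₀ = x₀ ∧
      ∀ t ∈ Set.Ioo (t₀ - 1 / (K + 1)) (t₀ + 1 / (K + 1)), HasDerivAt x (F (x t)) t := by
  set τ : ℝ := 1 / ((K : ℝ) + 1) with hτ
  have hτ0 : 0 < τ := by positivity
  have hmem : t₀ ∈ Set.Icc (t₀ - τ) (t₀ + τ) := ⟨by linarith, by linarith⟩
  -- On the ball of radius `a = ‖F x₀‖` the field is bounded by `a (K + 1)`, so a solution needs at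
  -- least time `1 / (K + 1)` to leave it, whatever `x₀` is.
  set a : ℝ≥0 := ‖F x₀‖₊ with ha
  have hPL : IsPicardLindelof (fun _ => F) (⟨t₀, hmem⟩ : Set.Icc (t₀ - τ) (t₀ + τ)) x₀ a 0
      (a * (K + 1)) K := by
    refine IsPicardLindelof.of_time_independent (fun x hx => ?_) hF.lipschitzOnWith ?_
    · have h1 := hF.dist_le_mul x x₀
      rw [Metric.mem_closedBall] at hx
      have h2 : (K : ℝ) * dist x x₀ ≤ K * a := by gcongr
      have h3 : ‖F x‖ ≤ ‖F x₀‖ + dist (F x) (F x₀) := by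
        rw [dist_eq_norm]
        simpa using norm_add_le (F x₀) (F x - F x₀)
      have h4 : (a : ℝ) = ‖F x₀‖ := rfl
      push_cast
      nlinarith
    · simp only [add_sub_cancel_left, sub_sub_cancel, max_self, NNReal.coe_zero, sub_zero]
      push_cast
      rw [hτ, mul_assoc, mul_one_div_cancel (by positivity), mul_one]
  obtain ⟨x, hx0, hx⟩ := hPL.exists_eq_forall_mem_Icc_hasDerivWithinAt₀
  exact ⟨x, hx0, fun t ht => (hx t (Set.Ioo_subset_Icc_self ht)).hasDerivAt (Icc_mem_nhds ht.1 ht.2)⟩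

/-- With `τ = 1 / (K + 1)`, restarting at `a - τ / 2` yields a solution that lives up to `a + τ /
2`, beyond the old endpoint. The two are glued at the restart time, around which they agree by
uniqueness. -/
theorem exists_hasDerivAt_extend_right [CompleteSpace X] (hF : LipschitzWith K F) {x : ℝ → X}
    {a b : ℝ} (hb : b < 0) (ha : 1 / (K + 1) / 2 < a)
    (hx : ∀ t ∈ Set.Ioo b a, HasDerivAt x (F (x t)) t) :
    ∃ y : ℝ → X, y 0 = x 0 ∧
      ∀ t ∈ Set.Ioo b (a + 1 / (K + 1) / 2), HasDerivAt y (F (y t)) t := by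
  set τ : ℝ := 1 / ((K : ℝ) + 1) with hτ
  have hτ0 : 0 < τ := by positivity
  set t₁ : ℝ := a - τ / 2 with ht₁
  obtain ⟨z, hz0, hz⟩ := exists_hasDerivAt_Ioo_uniform hF t₁ (x t₁)
  rw [← hτ] at hz
  have hev : x =ᶠ[𝓝 t₁] z := by
    refine ODE_solution_unique_of_eventually (v := fun _ => F) (s := fun _ => Set.univ) (K := K)
      (.of_forall fun _ => hF.lipschitzOnWith) ?_ ?_ hz0.symm
    · filter_upwards [Ioo_mem_nhds (show b < t₁ by linarith) (show t₁ < a by linarith)] with t ht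
      exact ⟨hx t ht, trivial⟩
    · filter_upwards [Ioo_mem_nhds (show t₁ - τ < t₁ by linarith)
        (show t₁ < t₁ + τ by linarith)] with t ht
      exact ⟨hz t ht, trivial⟩
  set y : ℝ → X := fun t => if t < t₁ then x t else z t with hy
  refine ⟨y, if_pos (by linarith), fun t ht => ?_⟩
  rcases lt_trichotomy t t₁ with h | h | h
  · have he : y =ᶠ[𝓝 t] x := by
      filter_upwards [Iio_mem_nhds h] with s hs using if_pos hs
    rw [he.eq_of_nhds]
    exact (hx t ⟨ht.1, by linarith⟩).congr_of_eventuallyEq he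
  · rw [h] at ht ⊢
    have he : y =ᶠ[𝓝 t₁] x := by
      filter_upwards [hev] with s hs
      by_cases h : s < t₁
      · exact if_pos h
      · exact (if_neg h).trans hs.symm
    rw [he.eq_of_nhds]
    exact (hx t₁ ⟨ht.1, by linarith⟩).congr_of_eventuallyEq he
  · have he : y =ᶠ[𝓝 t] z := by
      filter_upwards [Ioi_mem_nhds h] with s hs using if_neg (not_lt.2 (le_of_lt hs))
    rw [he.eq_of_nhds]
    exact (hz t ⟨by linarith, by linarith [ht.2]⟩).congr_of_eventuallyEq he

theorem hasDerivAt_comp_neg {x : ℝ → X} {t : ℝ} (h : HasDerivAt x (F (x (-t))) (-t)) :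
    HasDerivAt (fun s => x (-s)) (-F (x (-t))) t := by
  simpa [Function.comp_def] using h.scomp t (hasDerivAt_neg t)

/-- Each induction step gains `τ / 2` at both ends. The left end is reached by reversing time: `-F`
has the same Lipschitz constant, hence the same uniform existence time. -/
theorem exists_hasDerivAt_Ioo_nat [CompleteSpace X] (hF : LipschitzWith K F) (x₀ : X) (n : ℕ) :
    ∃ x : ℝ → X, x 0 = x₀ ∧ ∀ t ∈ Set.Ioo (-(1 / (K + 1) + n * (1 / (K + 1) / 2) : ℝ))
      (1 / (K + 1) + n * (1 / (K + 1) / 2)), HasDerivAt x (F (x t)) t := by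
  set τ : ℝ := 1 / ((K : ℝ) + 1) with hτ
  have hτ0 : 0 < τ := by positivity
  induction n with
  | zero =>
    obtain ⟨x, hx0, hx⟩ := exists_hasDerivAt_Ioo_uniform hF 0 x₀
    exact ⟨x, hx0, by simpa [hτ] using hx⟩
  | succ n ih =>
    obtain ⟨x, hx0, hx⟩ := ih
    set a : ℝ := τ + n * (τ / 2) with ha
    have hn : 0 ≤ (n : ℝ) * (τ / 2) := by positivity
    have ha' : τ + (n + 1 : ℕ) * (τ / 2) = a + τ / 2 := by push_cast; ring
    rw [ha']
    have hF' : LipschitzWith K fun y => -F y := hF.neg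
    obtain ⟨y, hy0, hy⟩ := exists_hasDerivAt_extend_right hF (show -a < 0 by linarith)
      (show τ / 2 < a by linarith) hx
    rw [← hτ] at hy
    obtain ⟨z, hz0, hz⟩ := exists_hasDerivAt_extend_right hF.neg (x := fun t => y (-t))
      (a := a) (b := -(a + τ / 2)) (by linarith) (show τ / 2 < a by linarith)
      (fun t ht => hasDerivAt_comp_neg (hy (-t) ⟨by linarith [ht.2], by linarith [ht.1]⟩))
    rw [← hτ] at hz
    refine ⟨fun t => z (-t), by simp [hz0, hy0, hx0], fun t ht => ?_⟩
    have h := hasDerivAt_comp_neg (hz (-t) ⟨by linarith [ht.2], by linarith [ht.1]⟩)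
    simpa using h

/-- A globally Lipschitz field has a global flow. -/
theorem exists_global_flow [CompleteSpace X] (hF : LipschitzWith K F) :
    ∃ flow : ℝ → X → X, ∀ x, flow 0 x = x ∧
      ∀ t, HasDerivAt (fun r => flow r x) (F (flow t x)) t := by
  choose u hu0 hu using fun (x₀ : X) (n : ℕ) => exists_hasDerivAt_Ioo_nat hF x₀ n
  set τ : ℝ := 1 / ((K : ℝ) + 1) with hτ
  have hτ0 : 0 < τ := by positivity
  set I : ℕ → Set ℝ := fun n => Set.Ioo (-(τ + n * (τ / 2))) (τ + n * (τ / 2)) with hI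
  have h0 : ∀ n, (0 : ℝ) ∈ I n := fun n => by
    have : 0 ≤ (n : ℝ) * (τ / 2) := by positivity
    exact ⟨by linarith, by linarith⟩
  have hmono : ∀ {m n : ℕ}, m ≤ n → I m ⊆ I n := fun {m n} hmn => by
    have : (m : ℝ) * (τ / 2) ≤ n * (τ / 2) := by gcongr
    exact Set.Ioo_subset_Ioo (by linarith) (by linarith)
  have hex : ∀ t : ℝ, ∃ n, t ∈ I n := fun t => by
    obtain ⟨n, hn⟩ := exists_nat_gt (|t| / (τ / 2))
    rw [div_lt_iff₀ (by positivity)] at hn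
    exact ⟨n, by linarith [neg_abs_le t], by linarith [le_abs_self t]⟩
  choose N hN using hex
  have hcomp : ∀ x (m n : ℕ), m ≤ n → Set.EqOn (u x m) (u x n) (I m) := fun x m n hmn =>
    eqOn_Ioo_of_hasDerivAt hF (h0 m) (hu x m) (fun t ht => hu x n t (hmono hmn ht))
      ((hu0 x m).trans (hu0 x n).symm)
  have hcomp' : ∀ x (m n : ℕ) t, t ∈ I m → t ∈ I n → u x m t = u x n t := fun x m n t hm hn => by
    rcases le_total m n with h | h
    · exact hcomp x m n h hm
    · exact (hcomp x n m h hn).symm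
  -- The index `N s` may jump with `s`, but the solutions agree on overlaps, so near `t` the flow
  -- coincides with the single solution `u x (N t)`.
  refine ⟨fun t x => u x (N t) t, fun x => ⟨hu0 x _, fun t => ?_⟩⟩
  refine (hu x (N t) t (hN t)).congr_of_eventuallyEq ?_
  filter_upwards [Ioo_mem_nhds (hN t).1 (hN t).2] with s hs
  exact hcomp' x _ _ s (hN s) hs

/-- Solutions of a Lipschitz equation depend continuously on the initial value. -/
theorem continuous_flow (hF : LipschitzWith K F) {flow : ℝ → X → X}
    (hflow : ∀ x, flow 0 x = x ∧ ∀ t, HasDerivAt (fun r => flow r x) (F (flow t x)) t)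
    {T : ℝ} (hT : 0 ≤ T) : Continuous (flow T) := by
  refine LipschitzWith.continuous (K := (Real.exp (K * T)).toNNReal)
    (LipschitzWith.of_dist_le_mul fun x y => ?_)
  have h := dist_le_of_trajectories_ODE (v := fun _ => F) (K := K) (a := 0) (b := T)
    (δ := dist x y) (f := fun r => flow r x) (g := fun r => flow r y) (fun _ => hF)
    (fun t _ => ((hflow x).2 t).continuousAt.continuousWithinAt)
    (fun t _ => ((hflow x).2 t).hasDerivWithinAt)
    (fun t _ => ((hflow y).2 t).continuousAt.continuousWithinAt)
    (fun t _ => ((hflow y).2 t).hasDerivWithinAt)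
    (by rw [(hflow x).1, (hflow y).1]) T ⟨hT, le_rfl⟩
  rw [Real.coe_toNNReal _ (Real.exp_pos _).le]
  simpa [mul_comm] using h

end LipschitzODE

/-! ### Convergence of one-step schemes and trapezoidal sums. -/

section OneStepScheme

theorem exists_norm_le_on_Icc {X : Type*} [NormedAddCommGroup X] {x : ℝ → X} (hx : Continuous x) (T : ℝ) :
    ∃ R, 0 ≤ R ∧ ∀ t ∈ Set.Icc 0 T, ‖x t‖ ≤ R := by
  obtain ⟨R, hR⟩ := (isCompact_Icc (a := (0 : ℝ)) (b := T)).exists_bound_of_continuousOn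
    hx.continuousOn
  exact ⟨max R 0, le_max_right _ _, fun t ht => (hR t ht).trans (le_max_left _ _)⟩

variable {X : Type*} [NormedAddCommGroup X] [NormedSpace ℝ X] {F : X → X} {K : ℝ≥0} {x : ℝ → X}

/-- On bounded time intervals a solution is Lipschitz in time. -/
theorem exists_norm_sub_le_mul (hF : LipschitzWith K F) (hx : ∀ t, HasDerivAt x (F (x t)) t)
    (T : ℝ) : ∃ B, 0 ≤ B ∧ ∀ s ∈ Set.Icc 0 T, ∀ t ∈ Set.Icc s T, ‖x t - x s‖ ≤ B * (t - s) := by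
  obtain ⟨B, hB0, hB⟩ := exists_norm_le_on_Icc (x := fun t => F (x t))
    (hF.continuous.comp (continuous_iff_continuousAt.2 fun t => (hx t).continuousAt)) T
  refine ⟨B, hB0, fun s hs t ht => ?_⟩
  refine norm_image_sub_le_of_norm_deriv_le_segment' (f' := fun r => F (x r))
    (fun r _ => (hx r).hasDerivWithinAt) (fun r hr => hB r ⟨?_, ?_⟩) t ⟨ht.1, le_rfl⟩
  · exact hs.1.trans hr.1
  · exact hr.2.le.trans ht.2

/-- A consistent one-step scheme of order one converges, with an error of the order of the step
size. -/
theorem exists_scheme_error_le (hF : LipschitzWith K F) (hx : ∀ t, HasDerivAt x (F (x t)) t)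
    {Ψ : ℝ → X → X} {M : ℝ} (hM : 0 ≤ M)
    (hΨ : ∀ h ∈ Set.Icc (0 : ℝ) 1, ∀ y, ‖Ψ h y - y - h • F y‖ ≤ M * h ^ 2 * (1 + ‖y‖)) (T : ℝ) :
    ∃ C, 0 ≤ C ∧ ∀ h ∈ Set.Icc (0 : ℝ) 1, ∀ n : ℕ, n * h ≤ T →
      ‖(Ψ h)^[n] (x 0) - x (n * h)‖ ≤ C * h := by
  obtain ⟨B, hB0, hB⟩ := exists_norm_sub_le_mul hF hx T
  obtain ⟨R, hR0, hR⟩ := exists_norm_le_on_Icc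
    (continuous_iff_continuousAt.2 fun t => (hx t).continuousAt) T
  -- The constants of the error recursion `e' ≤ (1 + c h) e + D h²`: amplification by the field and
  -- by the part of the consistency error that grows with `e`, and in `D` the consistency error on
  -- the ball of radius `R` plus the curvature of the exact solution.
  set c : ℝ := K + M with hc
  set D : ℝ := M * (1 + R) + K * B with hD
  have hD0 : 0 ≤ D := by positivity
  have hc0 : 0 ≤ c := by positivity
  have key : ∀ h ∈ Set.Icc (0 : ℝ) 1, ∀ n : ℕ, n * h ≤ T →
      ‖(Ψ h)^[n] (x 0) - x (n * h)‖ ≤ n * (D * h ^ 2) * Real.exp (c * (n * h)) := by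
    intro h hh n
    induction n with
    | zero => simp
    | succ n ih =>
      intro hn
      push_cast at hn ⊢
      have hh0 := hh.1
      have hnh : 0 ≤ n * h := by positivity
      have ih := ih (by linarith)
      rw [Function.iterate_succ_apply']
      set y := (Ψ h)^[n] (x 0) with hy
      set t : ℝ := n * h with ht
      have hts : ((n : ℝ) + 1) * h = t + h := by ring
      rw [hts] at hn ⊢
      set e := ‖y - x t‖ with he
      -- Subtracting the tangent line leaves the derivative `F (x s) - F (x t)`, which is of size `K
      -- B h`; no second derivative is required.
      have hloc : ‖x (t + h) - x t - h • F (x t)‖ ≤ K * B * h ^ 2 := by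
        have := norm_image_sub_le_of_norm_deriv_le_segment'
          (f := fun s => x s - (s - t) • F (x t)) (f' := fun s => F (x s) - F (x t))
          (a := t) (b := t + h) (C := K * B * h)
          (fun s _ => by
            have := (hx s).fun_sub (((hasDerivAt_id s).sub_const t).smul_const (F (x t)))
            simpa using this.hasDerivWithinAt)
          (fun s hs => by
            have h1 := hF.norm_sub_le (x s) (x t)
            have h2 := hB t ⟨hnh, by linarith⟩ s ⟨hs.1, by linarith [hs.2]⟩
            calc ‖F (x s) - F (x t)‖ ≤ K * (B * (s - t)) := h1.trans (by gcongr)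
              _ ≤ K * (B * h) := by gcongr; linarith [hs.2]
              _ = K * B * h := by ring) (t + h) ⟨by linarith, le_rfl⟩
        simp only [add_sub_cancel_left, sub_self, zero_smul, sub_zero] at this
        calc ‖x (t + h) - x t - h • F (x t)‖ = ‖x (t + h) - h • F (x t) - x t‖ := by
              congr 1; abel
          _ ≤ _ := this.trans (le_of_eq (by ring))
      have hyR : ‖y‖ ≤ R + e := by
        have := norm_add_le (x t) (y - x t)
        rw [add_sub_cancel] at this
        linarith [hR t ⟨hnh, by linarith⟩]
      have hFe : ‖h • (F y - F (x t))‖ ≤ h * (K * e) := by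
        rw [norm_smul, Real.norm_of_nonneg hh0]
        gcongr
        exact hF.norm_sub_le _ _
      have hstep : ‖Ψ h y - x (t + h)‖ ≤ (1 + c * h) * e + D * h ^ 2 := by
        have hdec : Ψ h y - x (t + h) = (Ψ h y - y - h • F y) + (y - x t)
            + h • (F y - F (x t)) - (x (t + h) - x t - h • F (x t)) := by
          rw [smul_sub]; abel
        have hcons := hΨ h hh y
        have h1 : M * h ^ 2 * (1 + ‖y‖) ≤ M * h ^ 2 * (1 + R) + M * h * e := by
          have hh2 : h ^ 2 ≤ h := by nlinarith [hh.2]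
          calc M * h ^ 2 * (1 + ‖y‖) ≤ M * h ^ 2 * (1 + (R + e)) := by gcongr
            _ = M * h ^ 2 * (1 + R) + M * h ^ 2 * e := by ring
            _ ≤ _ := by gcongr
        calc ‖Ψ h y - x (t + h)‖ ≤ ‖Ψ h y - y - h • F y‖ + ‖y - x t‖
              + ‖h • (F y - F (x t))‖ + ‖x (t + h) - x t - h • F (x t)‖ := by
              rw [hdec]
              exact (norm_sub_le _ _).trans (add_le_add_left (norm_add₃_le) _)
          _ ≤ (M * h ^ 2 * (1 + R) + M * h * e) + e + h * (K * e) + K * B * h ^ 2 := by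
              gcongr
              exact hcons.trans h1
          _ = _ := by rw [hc, hD]; ring
      have hexp : (1 + c * h) * Real.exp (c * t) ≤ Real.exp (c * (t + h)) := by
        rw [mul_add, Real.exp_add, mul_comm]
        gcongr
        linarith [Real.add_one_le_exp (c * h)]
      have hone : 1 ≤ Real.exp (c * (t + h)) := Real.one_le_exp (by positivity)
      calc ‖Ψ h y - x (t + h)‖ ≤ (1 + c * h) * (n * (D * h ^ 2) * Real.exp (c * t)) + D * h ^ 2 :=
            hstep.trans (by gcongr)
        _ = n * (D * h ^ 2) * ((1 + c * h) * Real.exp (c * t)) + D * h ^ 2 * 1 := by ring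
        _ ≤ n * (D * h ^ 2) * Real.exp (c * (t + h)) + D * h ^ 2 * Real.exp (c * (t + h)) := by
            gcongr
        _ = _ := by ring
  refine ⟨max T 0 * D * Real.exp (c * max T 0), by positivity, fun h hh n hn => ?_⟩
  have hh0 := hh.1
  have hT : n * h ≤ max T 0 := hn.trans (le_max_left _ _)
  calc ‖(Ψ h)^[n] (x 0) - x (n * h)‖ ≤ n * (D * h ^ 2) * Real.exp (c * (n * h)) := key h hh n hn
    _ = (n * h) * D * Real.exp (c * (n * h)) * h := by ring
    _ ≤ _ := by gcongr

/-- Trapezoidal sums along a convergent scheme converge to the increment of a potential along the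
solution. -/
theorem exists_trapezoid_error_le (hF : LipschitzWith K F) (hx : ∀ t, HasDerivAt x (F (x t)) t)
    {Ψ : ℝ → X → X} {M : ℝ} (hM : 0 ≤ M)
    (hΨ : ∀ h ∈ Set.Icc (0 : ℝ) 1, ∀ y, ‖Ψ h y - y - h • F y‖ ≤ M * h ^ 2 * (1 + ‖y‖))
    {A G : X → ℝ} (hA : ∀ t, HasDerivAt (fun s => A (x s)) (G (x t)) t) {L : ℝ} (hL : 0 ≤ L)
    (hG : ∀ y z, |G y - G z| ≤ L * (1 + ‖y‖ + ‖z‖) * ‖y - z‖) (T : ℝ) :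
    ∃ C, 0 ≤ C ∧ ∀ h ∈ Set.Icc (0 : ℝ) 1, ∀ n : ℕ, n * h ≤ T →
      |A (x (n * h)) - A (x 0)
        - ∑ i ∈ Finset.range n, h / 2 * (G ((Ψ h)^[i] (x 0)) + G ((Ψ h)^[i + 1] (x 0)))| ≤ C * h := by
  obtain ⟨B, hB0, hB⟩ := exists_norm_sub_le_mul hF hx T
  obtain ⟨R, hR0, hR⟩ := exists_norm_le_on_Icc
    (continuous_iff_continuousAt.2 fun t => (hx t).continuousAt) T
  obtain ⟨C, hC0, hC⟩ := exists_scheme_error_le hF hx hM hΨ T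
  set D : ℝ := L * (1 + R + (R + C)) * (B + C) with hD
  have hD0 : 0 ≤ D := by positivity
  have hclose : ∀ h ∈ Set.Icc (0 : ℝ) 1, ∀ i : ℕ, i * h ≤ T → ∀ s ∈ Set.Icc 0 T,
      |s - i * h| ≤ h → |G (x s) - G ((Ψ h)^[i] (x 0))| ≤ D * h := by
    intro h hh i hi s hs hsi
    have hh0 := hh.1
    have hih : 0 ≤ i * h := by positivity
    have h1 := hC h hh i hi
    have h2 : ‖x s - x (i * h)‖ ≤ B * h := by
      rcases le_total s (i * h) with hle | hle
      · rw [norm_sub_rev]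
        refine (hB s hs _ ⟨hle, hi⟩).trans ?_
        gcongr
        linarith [neg_abs_le (s - i * h)]
      · refine (hB _ ⟨hih, hi⟩ s ⟨hle, hs.2⟩).trans ?_
        gcongr
        linarith [le_abs_self (s - i * h)]
    have h3 : ‖x s - (Ψ h)^[i] (x 0)‖ ≤ (B + C) * h := by
      rw [norm_sub_rev] at h1
      calc _ ≤ ‖x s - x (i * h)‖ + ‖x (i * h) - (Ψ h)^[i] (x 0)‖ := norm_sub_le_norm_sub_add_norm_sub ..
        _ ≤ _ := by linarith
    have h4 : ‖(Ψ h)^[i] (x 0)‖ ≤ R + C := by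
      have h5 := norm_add_le (x (i * h)) ((Ψ h)^[i] (x 0) - x (i * h))
      rw [add_sub_cancel] at h5
      have h6 : C * h ≤ C := mul_le_of_le_one_right hC0 hh.2
      linarith [hR _ ⟨hih, hi⟩]
    calc _ ≤ L * (1 + ‖x s‖ + ‖(Ψ h)^[i] (x 0)‖) * ‖x s - (Ψ h)^[i] (x 0)‖ := hG _ _
      _ ≤ L * (1 + R + (R + C)) * ((B + C) * h) := by
        gcongr
        exact hR s hs
      _ = D * h := by rw [hD]; ring
  have key : ∀ h ∈ Set.Icc (0 : ℝ) 1, ∀ n : ℕ, n * h ≤ T →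
      |A (x (n * h)) - A (x 0)
        - ∑ i ∈ Finset.range n, h / 2 * (G ((Ψ h)^[i] (x 0)) + G ((Ψ h)^[i + 1] (x 0)))|
        ≤ n * (D * h ^ 2) := by
    intro h hh n
    have hh0 := hh.1
    induction n with
    | zero => simp
    | succ n ih =>
      intro hn
      have hn' : ((n : ℝ) + 1) * h ≤ T := by exact_mod_cast hn
      have hnh : 0 ≤ n * h := by positivity
      have ih := ih (by linarith)
      rw [Finset.sum_range_succ]
      -- Subtracting the line of slope `g` leaves the derivative `G (x s) - g`. Both numerical
      -- endpoint values are within `D h` of `G (x s)`, hence so is their mean.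
      set g : ℝ := (G ((Ψ h)^[n] (x 0)) + G ((Ψ h)^[n + 1] (x 0))) / 2 with hg
      have hloc := norm_image_sub_le_of_norm_deriv_le_segment'
          (f := fun s => A (x s) - (s - n * h) * g) (f' := fun s => G (x s) - g)
          (a := n * h) (b := (n + 1 : ℕ) * h) (C := D * h)
          (fun s _ => by
            have := (hA s).fun_sub (((hasDerivAt_id s).sub_const (n * h)).mul_const g)
            simpa using this.hasDerivWithinAt)
          (fun s hs => by
            have hs2 : s < (n + 1) * h := by exact_mod_cast hs.2
            have hsT : s ∈ Set.Icc 0 T := ⟨hnh.trans hs.1, by linarith⟩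
            have h1 := hclose h hh n (by linarith) s hsT
              (abs_le.2 ⟨by linarith [hs.1], by linarith⟩)
            have h2 := hclose h hh (n + 1) hn s hsT
              (by push_cast; exact abs_le.2 ⟨by linarith [hs.1], by linarith⟩)
            rw [abs_le] at h1 h2
            rw [Real.norm_eq_abs, abs_le, hg]
            constructor <;> linarith [h1.1, h1.2, h2.1, h2.2]) ((n + 1 : ℕ) * h)
            ⟨by push_cast; linarith, le_rfl⟩
      rw [Real.norm_eq_abs, abs_le] at hloc
      rw [abs_le] at ih ⊢
      push_cast at hloc ⊢
      constructor
      · nlinarith [hloc.1, ih.1]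
      · nlinarith [hloc.2, ih.2]
  refine ⟨max T 0 * D, by positivity, fun h hh n hn => (key h hh n hn).trans ?_⟩
  have hh0 := hh.1
  calc n * (D * h ^ 2) = n * h * D * h := by ring
    _ ≤ _ := by gcongr; exact hn.trans (le_max_left _ _)

end OneStepScheme

/-! ### Quasi-invariant maps and Metropolis kernels with deterministic proposals. -/

section Reversibility

variable {X : Type*} [MeasurableSpace X] {μ Q : Measure X}

/-- The map `ψ` transports the measure with density `exp w` with respect to `μ` to `μ`. -/
structure PreservesWith (μ : Measure X) (ψ : X → X) (w : X → ℝ) : Prop where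
  measurable : Measurable ψ
  measurable_weight : Measurable w
  lintegral_eq : ∀ f : X → ℝ≥0∞, Measurable f →
    ∫⁻ x, f (ψ x) * ENNReal.ofReal (Real.exp (w x)) ∂μ = ∫⁻ x, f x ∂μ

namespace PreservesWith

theorem id : PreservesWith μ id 0 :=
  ⟨measurable_id, measurable_zero, fun f _ => by simp⟩

theorem of_map_eq {ψ : X → X} (hψ : Measurable ψ) (h : μ.map ψ = μ) : PreservesWith μ ψ 0 :=
  ⟨hψ, measurable_zero, fun f hf => by
    conv_rhs => rw [← h, lintegral_map hf hψ]
    simp⟩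

/-- Log-densities form an additive cocycle, as log-Jacobians do in the chain rule. -/
theorem comp {ψ₁ ψ₂ : X → X} {w₁ w₂ : X → ℝ} (h₂ : PreservesWith μ ψ₂ w₂)
    (h₁ : PreservesWith μ ψ₁ w₁) : PreservesWith μ (ψ₂ ∘ ψ₁) (fun x => w₁ x + w₂ (ψ₁ x)) := by
  have hm₁ := h₁.measurable
  have hm₂ := h₂.measurable
  have hw₁ := h₁.measurable_weight
  have hw₂ := h₂.measurable_weight
  refine ⟨hm₂.comp hm₁, hw₁.add (hw₂.comp hm₁), fun f hf => ?_⟩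
  rw [← h₂.lintegral_eq f hf,
    ← h₁.lintegral_eq (fun x => f (ψ₂ x) * ENNReal.ofReal (Real.exp (w₂ x))) (by fun_prop)]
  refine lintegral_congr fun x => ?_
  rw [Real.exp_add, ENNReal.ofReal_mul (Real.exp_pos _).le, Function.comp_apply]
  ring

theorem iterate {ψ : X → X} {w : X → ℝ} (h : PreservesWith μ ψ w) (n : ℕ) :
    PreservesWith μ ψ^[n] (fun x => ∑ i ∈ Finset.range n, w (ψ^[i] x)) := by
  induction n with
  | zero => simpa using! PreservesWith.id
  | succ n ih =>
    rw [Function.iterate_succ']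
    simp_rw [Finset.sum_range_succ]
    exact h.comp ih

/-- Passing from `μ` to the exponentially tilted measure changes the weight by the increment of
the tilting function. -/
theorem tilted {ψ : X → X} {w g : X → ℝ} (h : PreservesWith μ ψ w) (hg : Measurable g) :
    PreservesWith (μ.tilted g) ψ (fun x => w x + (g (ψ x) - g x)) := by
  have hm := h.measurable
  have hw := h.measurable_weight
  refine ⟨hm, hw.add ((hg.comp hm).sub hg), fun f hf => ?_⟩
  rw [lintegral_tilted, lintegral_tilted]
  generalize hZ' : ∫ x, Real.exp (g x) ∂μ = Z
  -- The normaliser enters both sides in the same way, so integrability of `exp g` plays no role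
  -- here.
  have hZ : 0 ≤ Z := hZ' ▸ integral_nonneg fun _ => (Real.exp_pos _).le
  rw [
    ← h.lintegral_eq (fun x => ENNReal.ofReal (Real.exp (g x) / Z) * f x) (by fun_prop)]
  refine lintegral_congr fun x => ?_
  rw [show ∀ a b c : ℝ≥0∞, a * (b * c) = b * (a * c) by intros; ring,
    show ∀ a b c : ℝ≥0∞, a * b * c = b * (a * c) by intros; ring,
    ← ENNReal.ofReal_mul (by positivity), ← ENNReal.ofReal_mul (by positivity)]
  congr 2
  rw [div_mul_eq_mul_div, div_mul_eq_mul_div, ← Real.exp_add, ← Real.exp_add]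
  ring_nf

end PreservesWith

/-- Metropolis–Hastings with a deterministic proposal `ψ` such that `S ∘ ψ` is an involution is
reversible up to the involution `S`. -/
theorem isGeneralizedReversible_of_preservesWith {S ψ : X → X} {D : X → ℝ}
    (hS : Function.Involutive S) (hSm : Measurable S) (hSQ : Q.map S = Q)
    (hψS : Function.Involutive (S ∘ ψ)) (hD : ∀ x, D (S (ψ x)) = -D x)
    (hψ : PreservesWith Q ψ fun x => -D x) (p : Kernel X X)
    (hp : ∀ x, p x = ENNReal.ofReal (min 1 (Real.exp (-D x))) • Measure.dirac (ψ x)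
      + ENNReal.ofReal (1 - min 1 (Real.exp (-D x))) • Measure.dirac (S x)) :
    IsGeneralizedReversible p Q S := by
  intro A B hA hB
  have hψm := hψ.measurable
  have hDm : Measurable D := by
    simpa only [Pi.neg_def, neg_neg] using hψ.measurable_weight.neg
  have hSA : S '' A = S ⁻¹' A :=
    congrFun (Set.image_eq_preimage_of_inverse hS.leftInverse hS.rightInverse) A
  set a : X → ℝ≥0∞ := fun x => ENNReal.ofReal (min 1 (Real.exp (-D x))) with ha
  set r : X → ℝ≥0∞ := fun x => ENNReal.ofReal (1 - min 1 (Real.exp (-D x))) with hr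
  have ham : Measurable a := by fun_prop
  have hrm : Measurable r := by fun_prop
  set iA : X → ℝ≥0∞ := A.indicator 1 with hiA
  set iB : X → ℝ≥0∞ := B.indicator 1 with hiB
  have hiAm : Measurable iA := measurable_one.indicator hA
  have hiBm : Measurable iB := measurable_one.indicator hB
  have hleft : ∫⁻ x in A, p x B ∂Q
      = ∫⁻ x, iA x * a x * iB (ψ x) ∂Q + ∫⁻ x, iA x * r x * iB (S x) ∂Q := by
    rw [← lintegral_add_left (by fun_prop), ← lintegral_indicator hA]
    refine lintegral_congr fun x => ?_
    by_cases hx : x ∈ A <;>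
      simp [hx, hiA, hp, hB, hiB, ha, hr]
  have hright : ∫⁻ y in B, p (S y) (S '' A) ∂Q
      = ∫⁻ y, iA (S (ψ (S y))) * a (S y) * iB y ∂Q + ∫⁻ y, iA (S y) * r (S y) * iB y ∂Q := by
    rw [← lintegral_add_left (by fun_prop), ← lintegral_indicator hB, hSA]
    refine lintegral_congr fun y => ?_
    by_cases hy : y ∈ B
    · have hind : ∀ z, (S ⁻¹' A).indicator (1 : X → ℝ≥0∞) z = iA (S z) := fun z => rfl
      simp [hy, hp, hSm hA, hiB, ha, hr, hind, hS y, mul_comm]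
    · simp [hy, hiB]
  rw [hleft, hright]
  congr 1
  -- Accepted moves: the substitution `y = ψ x` produces the factor `exp (-D x)`, which turns the
  -- acceptance probability at `S (ψ x)` into the one at `x`.
  · rw [← hψ.lintegral_eq (fun y => iA (S (ψ (S y))) * a (S y) * iB y) (by fun_prop)]
    refine lintegral_congr fun x => ?_
    have h1 : S (ψ (S (ψ x))) = x := hψS x
    have h2 : a x = a (S (ψ x)) * ENNReal.ofReal (Real.exp (-D x)) := by
      simp only [ha, hD, neg_neg]
      rw [← ENNReal.ofReal_mul (by positivity), min_mul_of_nonneg _ _ (Real.exp_pos _).le,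
        ← Real.exp_add, add_neg_cancel, Real.exp_zero, one_mul, min_comm]
    rw [h1, h2]
    ring
  -- Rejected moves: the substitution `x = S y` suffices, as `Q` is invariant under `S`.
  · conv_lhs => rw [← hSQ]
    rw [lintegral_map (by fun_prop) hSm]
    simp_rw [hS _]

theorem exists_kernel_of_measurable {S ψ : X → X} {α : X → ℝ} (hS : Measurable S)
    (hψ : Measurable ψ) (hα : Measurable α) (h0 : ∀ x, 0 ≤ α x) (h1 : ∀ x, α x ≤ 1) :
    ∃ p : Kernel X X, IsMarkovKernel p ∧
      ∀ x, p x = ENNReal.ofReal (α x) • Measure.dirac (ψ x)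
        + ENNReal.ofReal (1 - α x) • Measure.dirac (S x) := by
  refine ⟨⟨fun x => ENNReal.ofReal (α x) • Measure.dirac (ψ x)
        + ENNReal.ofReal (1 - α x) • Measure.dirac (S x), ?_⟩, ⟨fun x => ⟨?_⟩⟩, fun x => rfl⟩
  · refine Measure.measurable_of_measurable_coe _ fun B hB => ?_
    have hBm : Measurable (B.indicator (1 : X → ℝ≥0∞)) := measurable_one.indicator hB
    simp only [Measure.coe_add, Measure.coe_smul, Pi.add_apply, Pi.smul_apply,
      Measure.dirac_apply' _ hB, smul_eq_mul]
    fun_prop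
  · change (ENNReal.ofReal (α x) • Measure.dirac (ψ x)
        + ENNReal.ofReal (1 - α x) • Measure.dirac (S x)) Set.univ = 1
    simp [← ENNReal.ofReal_add (h0 x) (sub_nonneg.2 (h1 x))]

/-- If `ψ` is a pointwise limit of maps preserving the probability measure `Q` up to weights that
tend to one, then `ψ` preserves `Q`. -/
theorem map_eq_of_tendsto_preservesWith [TopologicalSpace X] [BorelSpace X]
    [HasOuterApproxClosed X] [IsProbabilityMeasure Q] {ψ : X → X} (hψ : Measurable ψ)
    {ψ' : ℕ → X → X} {w : ℕ → X → ℝ} (h : ∀ n, PreservesWith Q (ψ' n) (w n))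
    (hlim : ∀ x, Tendsto (fun n => ψ' n x) atTop (𝓝 (ψ x)))
    (hw : ∀ x, Tendsto (fun n => w n x) atTop (𝓝 0)) : Q.map ψ = Q := by
  -- Fatou's lemma gives only one inequality, but it needs no uniform integrability of the weights.
  have hle : ∀ f : BoundedContinuousFunction X ℝ≥0,
      ∫⁻ x, f (ψ x) ∂Q ≤ ∫⁻ x, f x ∂Q := by
    intro f
    have hfm : Measurable fun x => (f x : ℝ≥0∞) :=
      f.continuous.measurable.coe_nnreal_ennreal
    have hl : ∀ x, liminf (fun n => (f (ψ' n x) : ℝ≥0∞) * ENNReal.ofReal (Real.exp (w n x))) atTop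
        = f (ψ x) := by
      intro x
      refine Tendsto.liminf_eq ?_
      have h1 : Tendsto (fun n => (f (ψ' n x) : ℝ≥0∞)) atTop (𝓝 (f (ψ x))) :=
        ENNReal.tendsto_coe.2 ((f.continuous.tendsto _).comp (hlim x))
      have h2 : Tendsto (fun n => ENNReal.ofReal (Real.exp (w n x))) atTop (𝓝 1) := by
        simpa using ENNReal.tendsto_ofReal ((Real.continuous_exp.tendsto 0).comp (hw x))
      simpa using ENNReal.Tendsto.mul h1 (.inr ENNReal.one_ne_top) h2 (.inl one_ne_zero)
    calc ∫⁻ x, f (ψ x) ∂Q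
        = ∫⁻ x, liminf (fun n => (f (ψ' n x) : ℝ≥0∞) * ENNReal.ofReal (Real.exp (w n x))) atTop ∂Q :=
          lintegral_congr fun x => (hl x).symm
      _ ≤ liminf (fun n => ∫⁻ x, (f (ψ' n x) : ℝ≥0∞) * ENNReal.ofReal (Real.exp (w n x)) ∂Q) atTop :=
          lintegral_liminf_le fun n =>
            (hfm.comp (h n).measurable).mul (h n).measurable_weight.exp.ennreal_ofReal
      _ = ∫⁻ x, f x ∂Q := by
          simp_rw [fun n => (h n).lintegral_eq (fun x => (f x : ℝ≥0∞)) hfm]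
          simp
  have : IsProbabilityMeasure (Q.map ψ) := Measure.isProbabilityMeasure_map hψ.aemeasurable
  refine (ext_of_forall_lintegral_eq_of_IsFiniteMeasure fun f => ?_)
  have hfm : Measurable fun x => (f x : ℝ≥0∞) := f.continuous.measurable.coe_nnreal_ennreal
  rw [lintegral_map hfm hψ]
  refine le_antisymm (hle f) ?_
  set M : ℝ≥0 := nndist f 0
  have hfM : ∀ x, f x ≤ M := BoundedContinuousFunction.NNReal.upper_bound f
  -- The reverse inequality: Fatou's bound for the nonnegative function `M - f`, both total masses
  -- being one.
  set g : BoundedContinuousFunction X ℝ≥0 := BoundedContinuousFunction.const X M - f with hg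
  have hadd : ∀ x, (f x : ℝ≥0∞) + g x = M := fun x => by
    rw [← ENNReal.coe_add]
    congr 1
    exact add_tsub_cancel_of_le (hfM x)
  have hgm : Measurable fun x => (g x : ℝ≥0∞) := g.continuous.measurable.coe_nnreal_ennreal
  have e1 : ∫⁻ x, f (ψ x) ∂Q + ∫⁻ x, g (ψ x) ∂Q = M := by
    rw [← lintegral_add_left (by exact hfm.comp hψ)]
    simp [hadd]
  have e2 : ∫⁻ x, f x ∂Q + ∫⁻ x, g x ∂Q = M := by
    rw [← lintegral_add_left hfm]
    simp [hadd]
  have hfin : ∫⁻ x, g x ∂Q ≠ ∞ := by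
    refine ne_top_of_le_ne_top (ENNReal.coe_ne_top (r := M)) ?_
    rw [← e2]
    exact le_add_self
  refine (ENNReal.add_le_add_iff_right hfin).1 ?_
  rw [e2, ← e1]
  exact add_le_add_right (hle g) _

end Reversibility

/-! ### The Hilbert space structure of `ℋˢ`. -/

namespace SobolevSpace

section HilbertStructure

variable {H : Type*} [NormedAddCommGroup H] [InnerProductSpace ℝ H]
  {φ : HilbertBasis ℕ ℝ H} {s : ℝ}

theorem weight_sq (s : ℝ) (j : ℕ) : ((j : ℝ) + 1) ^ (2 * s) = (((j : ℝ) + 1) ^ s) ^ 2 := by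
  rw [mul_comm, Real.rpow_mul (by positivity), Real.rpow_two]

theorem norm_sq_eq_tsum (f : SobolevSpace φ s) :
    ‖f‖ ^ 2 = ∑' j : ℕ, ((j : ℝ) + 1) ^ (2 * s) * ⟪toH f, φ j⟫_ℝ ^ 2 := by
  rw [← real_inner_self_eq_norm_sq, inner_def]
  exact tsum_congr fun j => by ring

theorem memℓp_coeff (f : SobolevSpace φ s) :
    Memℓp (fun j : ℕ => ((j : ℝ) + 1) ^ s * ⟪toH f, φ j⟫_ℝ) 2 := by
  refine memℓp_gen ((summable_sq f).congr fun j => ?_)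
  rw [ENNReal.toReal_ofNat, Real.rpow_two, norm_mul, mul_pow, Real.norm_eq_abs, Real.norm_eq_abs,
    sq_abs, sq_abs, weight_sq]

/-- The weighted coefficients give an isometry of `ℋˢ` into `ℓ²`. -/
def toEllTwo : SobolevSpace φ s →ₗᵢ[ℝ] lp (fun _ : ℕ => ℝ) 2 where
  toFun f := ⟨fun j : ℕ => ((j : ℝ) + 1) ^ s * ⟪toH f, φ j⟫_ℝ, memℓp_coeff f⟩
  map_add' f g := by
    ext j
    simp only [map_add, inner_add_left, mul_add]
    rfl
  map_smul' c f := by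
    ext j
    simp [map_smul, real_inner_smul_left]
    ring
  norm_map' f := by
    rw [← sq_eq_sq₀ (norm_nonneg _) (norm_nonneg _), norm_sq_eq_tsum,
      ← real_inner_self_eq_norm_sq, lp.inner_eq_tsum]
    refine tsum_congr fun j => ?_
    simp only [LinearMap.coe_mk, AddHom.coe_mk, real_inner_self_eq_norm_sq, Real.norm_eq_abs,
      sq_abs, mul_pow, weight_sq]

theorem toEllTwo_apply (f : SobolevSpace φ s) (j : ℕ) :
    toEllTwo f j = ((j : ℝ) + 1) ^ s * ⟪toH f, φ j⟫_ℝ := rfl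

/-- For `s ≥ 0` the weights are at least one, so dividing an `ℓ²` sequence by them keeps it in `ℓ²`
and defines a vector of `H`. -/
theorem toEllTwo_surjective (hs : 0 ≤ s) :
    Function.Surjective (toEllTwo : SobolevSpace φ s → lp (fun _ : ℕ => ℝ) 2) := by
  intro a
  have hw : ∀ j : ℕ, 1 ≤ ((j : ℝ) + 1) ^ s := fun j =>
    Real.one_le_rpow (by linarith [Nat.cast_nonneg (α := ℝ) j]) hs
  have ha : Summable fun j => ‖a j‖ ^ (2 : ℝ) := by
    simpa using (lp.memℓp a).summable (by simp)
  have hb : Memℓp (fun j : ℕ => (((j : ℝ) + 1) ^ s)⁻¹ * a j) 2 := by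
    refine memℓp_gen (Summable.of_nonneg_of_le (fun j => by positivity) (fun j => ?_) ha)
    rw [ENNReal.toReal_ofNat]
    gcongr
    rw [norm_mul, norm_inv, Real.norm_of_nonneg (by linarith [hw j])]
    exact mul_le_of_le_one_left (norm_nonneg _) (inv_le_one_of_one_le₀ (hw j))
  set x : H := φ.repr.symm ⟨_, hb⟩ with hx
  have hxj : ∀ j, ⟪x, φ j⟫_ℝ = (((j : ℝ) + 1) ^ s)⁻¹ * a j := fun j => by
    rw [real_inner_comm, ← φ.repr_apply_apply, hx, LinearIsometryEquiv.apply_symm_apply]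
  have hcancel : ∀ j : ℕ, ((j : ℝ) + 1) ^ s * ⟪x, φ j⟫_ℝ = a j := fun j => by
    rw [hxj, mul_inv_cancel_left₀ (by linarith [hw j])]
  have hmem : x ∈ sobolevSubmodule φ s := by
    refine ha.congr fun j => ?_
    rw [Real.rpow_two, ← hcancel, Real.norm_eq_abs, sq_abs, mul_pow, weight_sq]
  exact ⟨⟨x, hmem⟩, lp.ext (funext hcancel)⟩

/-- `ℋˢ` is isometric to `ℓ²`. -/
def ellTwoEquiv (hs : 0 ≤ s) : SobolevSpace φ s ≃ₗᵢ[ℝ] lp (fun _ : ℕ => ℝ) 2 :=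
  LinearIsometryEquiv.ofSurjective toEllTwo (toEllTwo_surjective hs)

theorem completeSpace (hs : 0 ≤ s) : CompleteSpace (SobolevSpace φ s) :=
  (completeSpace_congr (e := (ellTwoEquiv hs).toIsometryEquiv.toEquiv)
    (ellTwoEquiv hs).isometry.isUniformEmbedding).2 inferInstance

theorem secondCountableTopology [TopologicalSpace.SeparableSpace H] (hs : 0 ≤ s) :
    SecondCountableTopology (SobolevSpace φ s) := by
  have := UniformSpace.secondCountable_of_separable H
  exact ((ellTwoEquiv hs).trans φ.repr.symm).toHomeomorph.secondCountableTopology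

theorem toH_basisVec (j : ℕ) : toH (basisVec φ s j) = φ j := rfl

theorem norm_basisVec (j : ℕ) : ‖basisVec φ s j‖ = ((j : ℝ) + 1) ^ s := by
  rw [← sq_eq_sq₀ (norm_nonneg _) (by positivity), norm_sq_eq_tsum, tsum_eq_single j]
  · simp [toH_basisVec, weight_sq, φ.orthonormal.1 j]
  · intro i hi
    simp [toH_basisVec, φ.orthonormal.inner_eq_zero hi.symm]

/-- Every element of `ℋˢ` is the sum, in `ℋˢ`, of its expansion in the basis `φ`. -/
theorem hasSum_inner_smul_basisVec (hs : 0 ≤ s) (f : SobolevSpace φ s) :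
    HasSum (fun j => ⟪toH f, φ j⟫_ℝ • basisVec φ s j) f := by
  -- The orthonormal basis of `ℋˢ` obtained here consists of the `φⱼ` rescaled by `j^(-s)`; the
  -- scaling cancels in each term of the expansion.
  have h := (HilbertBasis.ofRepr (ellTwoEquiv hs : SobolevSpace φ s ≃ₗᵢ[ℝ] _)).hasSum_repr f
  convert! h using 2 with j
  have hw : (0 : ℝ) < ((j : ℝ) + 1) ^ s := by positivity
  have hb : (HilbertBasis.ofRepr (ellTwoEquiv hs : SobolevSpace φ s ≃ₗᵢ[ℝ] _)) j
      = (((j : ℝ) + 1) ^ s)⁻¹ • basisVec φ s j := by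
    rw [← HilbertBasis.repr_symm_single, LinearIsometryEquiv.symm_apply_eq]
    ext i
    change _ = toEllTwo ((((j : ℝ) + 1) ^ s)⁻¹ • basisVec φ s j) i
    rw [toEllTwo_apply, map_smul, real_inner_smul_left, toH_basisVec]
    by_cases hij : i = j
    · subst hij
      simp [hw.ne', φ.orthonormal.1 i]
    · simp [hij, φ.orthonormal.inner_eq_zero (Ne.symm hij)]
  rw [hb, smul_smul]
  congr 1
  change _ = toEllTwo f j * _
  rw [toEllTwo_apply]
  field_simp

theorem norm_toH_le (hs : 0 ≤ s) (f : SobolevSpace φ s) : ‖toH f‖ ≤ ‖f‖ := by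
  rw [← sq_le_sq₀ (norm_nonneg _) (norm_nonneg _), norm_sq_eq_tsum, ← real_inner_self_eq_norm_sq,
    ← φ.tsum_inner_mul_inner]
  refine Summable.tsum_le_tsum (fun j => ?_) (φ.summable_inner_mul_inner _ _) (summable_sq f)
  rw [real_inner_comm (toH f) (φ j), ← sq]
  have hw : 1 ≤ ((j : ℝ) + 1) ^ (2 * s) :=
    Real.one_le_rpow (by linarith [Nat.cast_nonneg (α := ℝ) j]) (by linarith)
  nlinarith [sq_nonneg ⟪toH f, φ j⟫_ℝ]

theorem continuous_toH (hs : 0 ≤ s) : Continuous (toH : SobolevSpace φ s → H) :=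
  AddMonoidHomClass.continuous_of_bound (toH : SobolevSpace φ s →ₗ[ℝ] H) 1
    fun f => by simpa using norm_toH_le hs f

theorem range_toH : Set.range (toH : SobolevSpace φ s → H) = sobolevSubmodule φ s :=
  Subtype.range_val

/-- An injective continuous map from a Polish space sends Borel sets to Borel sets (Lusin–Souslin).
This is what makes pulling the prior back to `ℋˡ` meaningful. -/
theorem measurableEmbedding_toH [MeasurableSpace H] [BorelSpace H]
    [TopologicalSpace.SeparableSpace H] (hs : 0 ≤ s) :
    MeasurableEmbedding (toH : SobolevSpace φ s → H) := by
  have := completeSpace (φ := φ) hs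
  have := secondCountableTopology (φ := φ) hs
  exact (continuous_toH hs).measurableEmbedding toH_injective

end HilbertStructure

end SobolevSpace

open SobolevSpace

/-! ### The covariance operator on the dual of `ℋˡ`. -/

section Covariance

variable {H : Type*} [NormedAddCommGroup H] [InnerProductSpace ℝ H]
  {φ : HilbertBasis ℕ ℝ H} {l : ℝ} {lam : ℕ → ℝ}

theorem abs_apply_basisVec_le (ξ : StrongDual ℝ (SobolevSpace φ l)) (j : ℕ) :
    |ξ (basisVec φ l j)| ≤ ‖ξ‖ * ((j : ℝ) + 1) ^ l := by
  simpa [norm_basisVec] using ξ.le_opNorm (basisVec φ l j)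

/-- The bound on `ξ(φⱼ)` and the norm of `φⱼ` in `ℋˡ` each contribute a factor `j^l`, whence the
role of `∑ⱼ j^(2l) λⱼ²`. -/
theorem norm_applyC_term_le (ξ : StrongDual ℝ (SobolevSpace φ l)) (j : ℕ) :
    ‖(lam j ^ 2 * ξ (basisVec φ l j)) • basisVec φ l j‖
      ≤ ((j : ℝ) + 1) ^ (2 * l) * lam j ^ 2 * ‖ξ‖ := by
  rw [norm_smul, norm_basisVec, norm_mul, Real.norm_eq_abs, Real.norm_eq_abs,
    abs_of_nonneg (sq_nonneg (lam j)), weight_sq]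
  calc lam j ^ 2 * |ξ (basisVec φ l j)| * ((j : ℝ) + 1) ^ l
      ≤ lam j ^ 2 * (‖ξ‖ * ((j : ℝ) + 1) ^ l) * ((j : ℝ) + 1) ^ l := by
        gcongr
        exact abs_apply_basisVec_le ξ j
    _ = _ := by ring

theorem norm_applyC_le (hS : Summable fun j : ℕ => ((j : ℝ) + 1) ^ (2 * l) * lam j ^ 2)
    (ξ : StrongDual ℝ (SobolevSpace φ l)) :
    ‖applyC lam ξ‖ ≤ (∑' j : ℕ, ((j : ℝ) + 1) ^ (2 * l) * lam j ^ 2) * ‖ξ‖ := by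
  rw [← tsum_mul_right]
  exact tsum_of_norm_bounded (hS.mul_right ‖ξ‖).hasSum fun j => norm_applyC_term_le ξ j

variable [CompleteSpace (SobolevSpace φ l)]

theorem summable_applyC (hS : Summable fun j : ℕ => ((j : ℝ) + 1) ^ (2 * l) * lam j ^ 2)
    (ξ : StrongDual ℝ (SobolevSpace φ l)) :
    Summable fun j => (lam j ^ 2 * ξ (basisVec φ l j)) • basisVec φ l j :=
  Summable.of_norm_bounded (hS.mul_right ‖ξ‖) fun j => norm_applyC_term_le ξ j

/-- `applyC` as a continuous linear map, when `∑ⱼ j^(2l) λⱼ²` is finite. -/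
def applyCL (lam : ℕ → ℝ) (hS : Summable fun j : ℕ => ((j : ℝ) + 1) ^ (2 * l) * lam j ^ 2) :
    StrongDual ℝ (SobolevSpace φ l) →L[ℝ] SobolevSpace φ l :=
  LinearMap.mkContinuous
    { toFun := applyC lam
      map_add' := fun ξ η => by
        rw [applyC, applyC, applyC, ← (summable_applyC hS ξ).tsum_add (summable_applyC hS η)]
        refine tsum_congr fun j => ?_
        rw [add_apply, ← add_smul]
        ring_nf
      map_smul' := fun c ξ => by
        rw [applyC, applyC, RingHom.id_apply, ← (summable_applyC hS ξ).tsum_const_smul]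
        refine tsum_congr fun j => ?_
        rw [smul_apply, smul_smul, smul_eq_mul]
        ring_nf }
    (∑' j : ℕ, ((j : ℝ) + 1) ^ (2 * l) * lam j ^ 2)
    (norm_applyC_le hS)

theorem applyCL_apply (hS : Summable fun j : ℕ => ((j : ℝ) + 1) ^ (2 * l) * lam j ^ 2)
    (ξ : StrongDual ℝ (SobolevSpace φ l)) : applyCL lam hS ξ = applyC lam ξ := rfl

theorem hasSum_apply_applyC (hS : Summable fun j : ℕ => ((j : ℝ) + 1) ^ (2 * l) * lam j ^ 2)
    (ξ η : StrongDual ℝ (SobolevSpace φ l)) :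
    HasSum (fun j => lam j ^ 2 * (ξ (basisVec φ l j) * η (basisVec φ l j))) (η (applyC lam ξ)) := by
  have h := (summable_applyC hS ξ).hasSum.mapL η
  simpa [mul_assoc, applyC] using h

theorem apply_applyC_comm (hS : Summable fun j : ℕ => ((j : ℝ) + 1) ^ (2 * l) * lam j ^ 2)
    (ξ η : StrongDual ℝ (SobolevSpace φ l)) : η (applyC lam ξ) = ξ (applyC lam η) := by
  rw [← (hasSum_apply_applyC hS ξ η).tsum_eq, ← (hasSum_apply_applyC hS η ξ).tsum_eq]
  exact tsum_congr fun j => by ring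

/-- Identifies the quadratic term of `ΔH` with the quadratic form appearing in the Cameron–Martin
density. -/
theorem sqNormSqrtC_eq (hS : Summable fun j : ℕ => ((j : ℝ) + 1) ^ (2 * l) * lam j ^ 2)
    (ξ : StrongDual ℝ (SobolevSpace φ l)) : sqNormSqrtC lam ξ = ξ (applyC lam ξ) := by
  rw [← (hasSum_apply_applyC hS ξ ξ).tsum_eq, sqNormSqrtC]
  exact tsum_congr fun j => by ring

end Covariance

/-! ### The prior as a Gaussian measure on `ℋˡ`. -/

section Prior

variable {H : Type*} [NormedAddCommGroup H] [InnerProductSpace ℝ H] [CompleteSpace H]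
  [SecondCountableTopology H] [MeasurableSpace H] [BorelSpace H]
  {π₀ : Measure H} [IsGaussian π₀] {φ : HilbertBasis ℕ ℝ H} {l : ℝ} {lam : ℕ → ℝ}

theorem integral_inner_sum_sq_of_eigenbasis
    (heig : ∀ j, covarianceOperator π₀ (φ j) = lam j ^ 2 • φ j) (n : ℕ) (a : ℕ → ℝ) :
    ∫ x, ⟪∑ j ∈ Finset.range n, a j • φ j, x⟫_ℝ ^ 2 ∂π₀
      = ∑ j ∈ Finset.range n, lam j ^ 2 * a j ^ 2 := by
  have h := covarianceOperator_inner (IsGaussian.memLp_two_id (μ := π₀))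
    (∑ j ∈ Finset.range n, a j • φ j) (∑ j ∈ Finset.range n, a j • φ j)
  simp_rw [← sq] at h
  rw [← h, map_sum]
  simp_rw [map_smul, heig, smul_smul]
  rw [φ.orthonormal.inner_sum]
  refine Finset.sum_congr rfl fun j _ => ?_
  simp
  ring

theorem lintegral_inner_basis_sq
    (heig : ∀ j, covarianceOperator π₀ (φ j) = lam j ^ 2 • φ j) (j : ℕ) :
    ∫⁻ x, ENNReal.ofReal (⟪x, φ j⟫_ℝ ^ 2) ∂π₀ = ENNReal.ofReal (lam j ^ 2) := by
  have h := covarianceOperator_inner (IsGaussian.memLp_two_id (μ := π₀)) (φ j) (φ j)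
  rw [heig, real_inner_smul_left, real_inner_self_eq_norm_sq, φ.orthonormal.1 j] at h
  simp_rw [← sq, real_inner_comm _ (φ j)] at h
  have hint : Integrable (fun x => ⟪x, φ j⟫_ℝ ^ 2) π₀ := by
    have h2 : MemLp (fun x => ⟪x, φ j⟫_ℝ) 2 π₀ := by
      simpa [real_inner_comm] using IsGaussian.memLp_dual π₀ (innerSL ℝ (φ j)) 2 (by simp)
    exact h2.integrable_sq
  rw [← ofReal_integral_eq_lintegral_ofReal hint (.of_forall fun x => sq_nonneg _), ← h]
  simp

/-- The Gaussian measure is concentrated on `ℋˡ` if `∑ⱼ j^(2l) λⱼ²` is finite. -/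
theorem ae_mem_sobolevSubmodule
    (heig : ∀ j, covarianceOperator π₀ (φ j) = lam j ^ 2 • φ j)
    (hS : Summable fun j : ℕ => ((j : ℝ) + 1) ^ (2 * l) * lam j ^ 2) :
    ∀ᵐ x ∂π₀, x ∈ sobolevSubmodule φ l := by
  have hm : ∀ j : ℕ, Measurable fun x : H =>
      ENNReal.ofReal (((j : ℝ) + 1) ^ (2 * l) * ⟪x, φ j⟫_ℝ ^ 2) := fun j => by fun_prop
  -- The expectation of `‖x‖_l²` is `∑ⱼ j^(2l) λⱼ²`, so the norm is almost surely finite.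
  have hfin : ∫⁻ x, ∑' j : ℕ, ENNReal.ofReal (((j : ℝ) + 1) ^ (2 * l) * ⟪x, φ j⟫_ℝ ^ 2) ∂π₀
      ≠ ∞ := by
    rw [lintegral_tsum fun j => (hm j).aemeasurable]
    have : ∀ j : ℕ, ∫⁻ x, ENNReal.ofReal (((j : ℝ) + 1) ^ (2 * l) * ⟪x, φ j⟫_ℝ ^ 2) ∂π₀
        = ENNReal.ofReal (((j : ℝ) + 1) ^ (2 * l) * lam j ^ 2) := fun j => by
      have hw : (0 : ℝ) ≤ ((j : ℝ) + 1) ^ (2 * l) := by positivity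
      simp_rw [ENNReal.ofReal_mul hw]
      rw [lintegral_const_mul _ (by fun_prop), lintegral_inner_basis_sq heig]
    simp_rw [this]
    exact hS.tsum_ofReal_ne_top
  filter_upwards [ae_lt_top (Measurable.tsum hm) hfin] with x hx
  have h := ENNReal.summable_toReal hx.ne
  refine h.congr fun j => ENNReal.toReal_ofReal (by positivity)

theorem map_toH_comap (hl0 : 0 ≤ l)
    (heig : ∀ j, covarianceOperator π₀ (φ j) = lam j ^ 2 • φ j)
    (hS : Summable fun j : ℕ => ((j : ℝ) + 1) ^ (2 * l) * lam j ^ 2) :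
    (π₀.comap (toH : SobolevSpace φ l → H)).map toH = π₀ := by
  rw [(measurableEmbedding_toH hl0).map_comap, range_toH]
  exact Measure.restrict_eq_self_of_ae_mem (ae_mem_sobolevSubmodule heig hS)

theorem isProbabilityMeasure_comap_toH (hl0 : 0 ≤ l)
    (heig : ∀ j, covarianceOperator π₀ (φ j) = lam j ^ 2 • φ j)
    (hS : Summable fun j : ℕ => ((j : ℝ) + 1) ^ (2 * l) * lam j ^ 2) :
    IsProbabilityMeasure (π₀.comap (toH : SobolevSpace φ l → H)) := by
  have h := map_toH_comap (φ := φ) hl0 heig hS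
  have : IsProbabilityMeasure ((π₀.comap (toH : SobolevSpace φ l → H)).map toH) := by
    rw [h]; infer_instance
  exact Measure.isProbabilityMeasure_of_map toH

/-- A functional on `ℋˡ` need not extend continuously to `H`. It is the pointwise limit of its
truncations `⟪∑_{j<n} ξ(φⱼ) φⱼ, ·⟫`, which do, and whose characteristic functions are known;
dominated convergence concludes. -/
theorem charFunDual_comap_toH (hmean : ∫ x, x ∂π₀ = 0) (hl0 : 0 ≤ l)
    [CompleteSpace (SobolevSpace φ l)]
    (heig : ∀ j, covarianceOperator π₀ (φ j) = lam j ^ 2 • φ j)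
    (hS : Summable fun j : ℕ => ((j : ℝ) + 1) ^ (2 * l) * lam j ^ 2)
    (ξ : StrongDual ℝ (SobolevSpace φ l)) :
    charFunDual (π₀.comap (toH : SobolevSpace φ l → H)) ξ
      = Complex.exp (-(ξ (applyC lam ξ) / 2 : ℝ)) := by
  have hprob := isProbabilityMeasure_comap_toH (φ := φ) hl0 heig hS
  set γ := π₀.comap (toH : SobolevSpace φ l → H) with hγ
  have hmeas := (measurableEmbedding_toH (φ := φ) hl0).measurable
  set a : ℕ → ℝ := fun j => ξ (basisVec φ l j) with ha
  set u : ℕ → H := fun n => ∑ j ∈ Finset.range n, a j • φ j with hu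
  have hval : ∀ n, ∫ f, Complex.exp (⟪u n, toH f⟫_ℝ * Complex.I) ∂γ
      = Complex.exp (-((∑ j ∈ Finset.range n, lam j ^ 2 * a j ^ 2) / 2 : ℝ)) := by
    intro n
    have h1 := charFunDual_of_centered hmean (innerSL ℝ (u n))
    rw [variance_of_integral_eq_zero (by fun_prop)
      (by rw [IsGaussian.integral_dual, hmean, map_zero])] at h1
    simp only [innerSL_apply_apply] at h1
    rw [integral_inner_sum_sq_of_eigenbasis heig, charFunDual_apply] at h1
    rw [← h1, ← map_toH_comap (φ := φ) hl0 heig hS, integral_map hmeas.aemeasurable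
      (Measurable.aestronglyMeasurable (by fun_prop))]
    rfl
  have hlim : ∀ f : SobolevSpace φ l, Tendsto (fun n => ⟪u n, toH f⟫_ℝ) atTop (𝓝 (ξ f)) := by
    intro f
    have h := ((hasSum_inner_smul_basisVec hl0 f).mapL ξ).tendsto_sum_nat
    refine h.congr fun n => ?_
    simp only [hu, ha, sum_inner, real_inner_smul_left, map_smul, smul_eq_mul]
    exact Finset.sum_congr rfl fun j _ => by rw [real_inner_comm (φ j) (toH f), mul_comm]
  have hleft : Tendsto (fun n => ∫ f, Complex.exp (⟪u n, toH f⟫_ℝ * Complex.I) ∂γ) atTop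
      (𝓝 (∫ f, Complex.exp (ξ f * Complex.I) ∂γ)) := by
    refine tendsto_integral_of_dominated_convergence (fun _ => 1)
      (fun n => Measurable.aestronglyMeasurable (by fun_prop)) (integrable_const _)
      (fun n => .of_forall fun f => by rw [Complex.norm_exp_ofReal_mul_I])
      (.of_forall fun f => ?_)
    exact (Complex.continuous_exp.tendsto _).comp
      (((Complex.continuous_ofReal.tendsto _).comp (hlim f)).mul_const _)
  have hright : Tendsto (fun n =>
      Complex.exp (-((∑ j ∈ Finset.range n, lam j ^ 2 * a j ^ 2) / 2 : ℝ))) atTop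
      (𝓝 (Complex.exp (-(ξ (applyC lam ξ) / 2 : ℝ)))) := by
    have h := (hasSum_apply_applyC hS ξ ξ).tendsto_sum_nat
    simp_rw [← sq] at h
    exact (Complex.continuous_exp.tendsto _).comp
      ((Complex.continuous_ofReal.tendsto _).comp (h.div_const 2)).neg
  rw [charFunDual_apply]
  refine tendsto_nhds_unique hleft ?_
  simp_rw [hval]
  exact hright

/-- The restriction of the prior to `ℋˡ` is a centred Gaussian measure with covariance `C`. -/
theorem isGaussian_comap_toH (hmean : ∫ x, x ∂π₀ = 0) (hl0 : 0 ≤ l)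
    [CompleteSpace (SobolevSpace φ l)] [SecondCountableTopology (SobolevSpace φ l)]
    (heig : ∀ j, covarianceOperator π₀ (φ j) = lam j ^ 2 • φ j)
    (hS : Summable fun j : ℕ => ((j : ℝ) + 1) ^ (2 * l) * lam j ^ 2) :
    IsGaussian (π₀.comap (toH : SobolevSpace φ l → H)) ∧
    ∫ f, f ∂(π₀.comap (toH : SobolevSpace φ l → H)) = 0 ∧
    ∀ ξ η : StrongDual ℝ (SobolevSpace φ l),
      cov[ξ, η; π₀.comap (toH : SobolevSpace φ l → H)] = η (applyC lam ξ) := by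
  have hprob := isProbabilityMeasure_comap_toH (φ := φ) hl0 heig hS
  set B : StrongDual ℝ (SobolevSpace φ l) →L[ℝ] StrongDual ℝ (SobolevSpace φ l) →L[ℝ] ℝ :=
    (ContinuousLinearMap.apply ℝ ℝ).comp (applyCL lam hS) with hB
  have hBapp : ∀ ξ η, B ξ η = η (applyC lam ξ) := fun ξ η => rfl
  have hpos : B.toBilinForm.IsPosSemidef :=
    { eq := fun ξ η => by
        change B ξ η = B η ξ
        rw [hBapp, hBapp, apply_applyC_comm hS]
      nonneg := fun ξ => by
        change 0 ≤ B ξ ξ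
        rw [hBapp, ← sqNormSqrtC_eq hS]
        exact tsum_nonneg fun j => sq_nonneg _ }
  have hchar : ∀ ξ, charFunDual (π₀.comap (toH : SobolevSpace φ l → H)) ξ
      = Complex.exp (ξ (0 : SobolevSpace φ l) * Complex.I - (B ξ ξ : ℝ) / 2) := fun ξ => by
    rw [charFunDual_comap_toH hmean hl0 heig hS, hBapp]
    simp
  have hG : IsGaussian (π₀.comap (toH : SobolevSpace φ l → H)) :=
    isGaussian_iff_gaussian_charFunDual.2 ⟨0, B, hpos, hchar⟩
  -- A characteristic function of Gaussian form determines its mean and covariance.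
  obtain ⟨h0, hc⟩ := gaussian_charFunDual_congr hpos hchar
  refine ⟨hG, h0.symm, fun ξ η => ?_⟩
  rw [← covarianceBilinDual_eq_covariance IsGaussian.memLp_two_id, ← hc, hBapp]

end Prior

/-! ### Time reversal of iterates. -/

section Involution

theorem involutive_comp_iterate {X : Type*} {S ψ : X → X} (hS : Function.Involutive S)
    (h : ∀ x, ψ (S (ψ x)) = S x) (n : ℕ) : Function.Involutive (S ∘ ψ^[n]) := by
  have hn : ∀ x, ψ^[n] (S (ψ^[n] x)) = S x := by
    induction n with
    | zero => simp
    | succ n ih =>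
      intro x
      rw [Function.iterate_succ_apply' ψ n x, Function.iterate_succ_apply ψ n, h, ih]
  intro x
  simp only [Function.comp_apply, hn, hS x]

theorem iterate_flip_iterate {X : Type*} {S ψ : X → X} (h : ∀ x, ψ (S (ψ x)) = S x)
    {i n : ℕ} (hi : i ≤ n) (x : X) : ψ^[i] (S (ψ^[n] x)) = S (ψ^[n - i] x) := by
  induction i with
  | zero => simp
  | succ i ih =>
    have e : n - i = (n - (i + 1)) + 1 := by omega
    rw [Function.iterate_succ_apply', ih (by omega), e, Function.iterate_succ_apply', h]

end Involution

/-! ### Time reversal and the energy error. -/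

section Algebra

variable {H : Type*} [NormedAddCommGroup H] [InnerProductSpace ℝ H]
  {φ : HilbertBasis ℕ ℝ H} {l : ℝ} {lam : ℕ → ℝ} {Φ : SobolevSpace φ l → ℝ}

theorem velocityFlip_involutive :
    Function.Involutive (velocityFlip (φ := φ) (l := l)) := fun x => by
  simp [velocityFlip]

theorem continuous_velocityFlip : Continuous (velocityFlip (φ := φ) (l := l)) := by
  unfold velocityFlip
  fun_prop

theorem flowB_velocityFlip_flowB (t : ℝ) (x : SobolevSpace φ l × SobolevSpace φ l) :
    flowB lam Φ t (velocityFlip (flowB lam Φ t x)) = velocityFlip x := by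
  simp [flowB, velocityFlip]

theorem flowA_velocityFlip_flowA (t : ℝ) (x : SobolevSpace φ l × SobolevSpace φ l) :
    flowA t (velocityFlip (flowA t x)) = velocityFlip x := by
  have h := Real.sin_sq_add_cos_sq t
  ext1
  · simp only [flowA, velocityFlip]
    match_scalars <;> first | ring1 | linear_combination h
  · simp only [flowA, velocityFlip]
    match_scalars <;> first | ring1 | linear_combination -h

theorem integratorStep_velocityFlip_integratorStep (h : ℝ)
    (x : SobolevSpace φ l × SobolevSpace φ l) :
    integratorStep lam Φ h (velocityFlip (integratorStep lam Φ h x)) = velocityFlip x := by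
  simp only [integratorStep, flowB_velocityFlip_flowB, flowA_velocityFlip_flowA]

/-- The contribution of one step of the integrator to the energy error, apart from the increment of
the potential. -/
def stepError (lam : ℕ → ℝ) (Φ : SobolevSpace φ l → ℝ) (h : ℝ)
    (x : SobolevSpace φ l × SobolevSpace φ l) : ℝ :=
  h ^ 2 / 8 * (sqNormSqrtC lam (fderiv ℝ Φ x.1)
      - sqNormSqrtC lam (fderiv ℝ Φ (integratorStep lam Φ h x).1))
    - h / 2 * (fderiv ℝ Φ x.1 x.2
      + fderiv ℝ Φ (integratorStep lam Φ h x).1 (integratorStep lam Φ h x).2)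

/-- The reversed step exchanges the two endpoints, under which the difference of squares is odd, and
negates both velocities, in which the remaining term is linear. -/
theorem stepError_velocityFlip_integratorStep (h : ℝ) (x : SobolevSpace φ l × SobolevSpace φ l) :
    stepError lam Φ h (velocityFlip (integratorStep lam Φ h x)) = -stepError lam Φ h x := by
  simp only [stepError, integratorStep_velocityFlip_integratorStep]
  simp only [velocityFlip, map_neg]
  ring

/-- At least one step is required: with zero steps the trapezoidal sum is empty, whereas the two
endpoint terms in `energyError` remain. -/
theorem energyError_eq_trapezoid (h : ℝ) (n : ℕ) (x : SobolevSpace φ l × SobolevSpace φ l) :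
    energyError lam Φ h (n + 1) x
      = Φ ((integratorStep lam Φ h)^[n + 1] x).1 - Φ x.1
        + h ^ 2 / 8 * (sqNormSqrtC lam (fderiv ℝ Φ x.1)
          - sqNormSqrtC lam (fderiv ℝ Φ ((integratorStep lam Φ h)^[n + 1] x).1))
        - ∑ i ∈ Finset.range (n + 1), h / 2 *
          (fderiv ℝ Φ ((integratorStep lam Φ h)^[i] x).1 ((integratorStep lam Φ h)^[i] x).2
          + fderiv ℝ Φ ((integratorStep lam Φ h)^[i + 1] x).1
            ((integratorStep lam Φ h)^[i + 1] x).2) := by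
  set g : ℕ → ℝ := fun i =>
    fderiv ℝ Φ ((integratorStep lam Φ h)^[i] x).1 ((integratorStep lam Φ h)^[i] x).2 with hg
  have hsum : ∑ i ∈ Finset.range (n + 1), h / 2 * (g i + g (i + 1))
      = h * ∑ i ∈ Finset.Ico 1 (n + 1), g i + h / 2 * (g 0 + g (n + 1)) := by
    rw [← Finset.mul_sum, Finset.sum_add_distrib, Finset.sum_range_succ' g, Finset.sum_range_succ
      (fun i => g (i + 1)), Finset.sum_Ico_eq_sum_range, Nat.add_sub_cancel]
    simp_rw [add_comm 1]
    ring
  have hE : energyError lam Φ h (n + 1) x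
      = Φ ((integratorStep lam Φ h)^[n + 1] x).1 - Φ x.1
        + h ^ 2 / 8 * (sqNormSqrtC lam (fderiv ℝ Φ x.1)
          - sqNormSqrtC lam (fderiv ℝ Φ ((integratorStep lam Φ h)^[n + 1] x).1))
        - h * ∑ i ∈ Finset.Ico 1 (n + 1), g i - h / 2 * (g 0 + g (n + 1)) := rfl
  rw [hE]
  change _ = _ - ∑ i ∈ Finset.range (n + 1), h / 2 * (g i + g (i + 1))
  rw [hsum]
  ring

theorem energyError_eq_sum_stepError (h : ℝ) (n : ℕ) (x : SobolevSpace φ l × SobolevSpace φ l) :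
    energyError lam Φ h (n + 1) x
      = Φ ((integratorStep lam Φ h)^[n + 1] x).1 - Φ x.1
        + ∑ i ∈ Finset.range (n + 1), stepError lam Φ h ((integratorStep lam Φ h)^[i] x) := by
  have h1 : ∀ m, ∑ i ∈ Finset.range m, (sqNormSqrtC lam
      (fderiv ℝ Φ ((integratorStep lam Φ h)^[i] x).1)
      - sqNormSqrtC lam (fderiv ℝ Φ ((integratorStep lam Φ h)^[i + 1] x).1))
      = sqNormSqrtC lam (fderiv ℝ Φ x.1)
        - sqNormSqrtC lam (fderiv ℝ Φ ((integratorStep lam Φ h)^[m] x).1) := fun m =>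
    Finset.sum_range_sub' (fun i => sqNormSqrtC lam
      (fderiv ℝ Φ ((integratorStep lam Φ h)^[i] x).1)) m
  rw [energyError_eq_trapezoid, ← h1, Finset.mul_sum, add_sub_assoc, ← Finset.sum_sub_distrib]
  simp only [stepError, Function.iterate_succ_apply']

/-- The flipped endpoint retraces the trajectory backwards, so the step errors reappear in reverse
order, each with opposite sign. -/
theorem energyError_velocityFlip (h : ℝ) (n : ℕ) (x : SobolevSpace φ l × SobolevSpace φ l) :
    energyError lam Φ h (n + 1) (velocityFlip ((integratorStep lam Φ h)^[n + 1] x))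
      = -energyError lam Φ h (n + 1) x := by
  have hrev := integratorStep_velocityFlip_integratorStep (lam := lam) (Φ := Φ) h
  rw [energyError_eq_sum_stepError, energyError_eq_sum_stepError,
    iterate_flip_iterate hrev le_rfl, Nat.sub_self, Function.iterate_zero_apply,
    ← Finset.sum_range_reflect, neg_add, ← Finset.sum_neg_distrib]
  congr 1
  · simp [velocityFlip]
  · refine Finset.sum_congr rfl fun i hi => ?_
    have hi' := Finset.mem_range.1 hi
    rw [iterate_flip_iterate hrev (by omega),
      show n + 1 - (n + 1 - 1 - i) = i + 1 by omega, Function.iterate_succ_apply',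
      stepError_velocityFlip_integratorStep]

theorem hamiltonianField_velocityFlip (x : SobolevSpace φ l × SobolevSpace φ l) :
    hamiltonianField lam Φ (velocityFlip x) = -velocityFlip (hamiltonianField lam Φ x) := by
  simp [hamiltonianField, velocityFlip, sub_eq_add_neg]

/-- Running a trajectory backwards with flipped velocity solves the same equation. By uniqueness it
is the flow started at the flipped endpoint. -/
theorem velocityFlip_flow_involutive {K' : ℝ≥0} (hF : LipschitzWith K' (hamiltonianField lam Φ))
    {flow : ℝ → SobolevSpace φ l × SobolevSpace φ l → SobolevSpace φ l × SobolevSpace φ l}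
    (hflow : IsExactFlow lam Φ flow) (T : ℝ) :
    Function.Involutive (velocityFlip ∘ flow T) := by
  intro x
  have hL : ∀ t, HasDerivAt (fun r => velocityFlip (flow (T - r) x))
      (hamiltonianField lam Φ (velocityFlip (flow (T - t) x))) t := fun t => by
    have h1 : HasDerivAt (fun r => flow (T - r) x) (-hamiltonianField lam Φ (flow (T - t) x)) t := by
      simpa using! ((hflow x).2 (T - t)).scomp t ((hasDerivAt_id t).const_sub T)
    rw [hamiltonianField_velocityFlip]
    have h2 := h1.hasFDerivAt.fst.hasDerivAt.prodMk h1.hasFDerivAt.snd.hasDerivAt.neg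
    simpa [velocityFlip] using! h2
  have heq := eq_of_forall_hasDerivAt hF (t₀ := 0) hL
    ((hflow (velocityFlip (flow T x))).2) (by simp [(hflow (velocityFlip (flow T x))).1])
  have h := congrFun heq T
  simp only [sub_self, (hflow x).1] at h
  simp only [Function.comp_apply, ← h, velocityFlip_involutive x]

end Algebra

/-! ### Lipschitz bounds and consistency of the integrator. -/

section Regularity

variable {H : Type*} [NormedAddCommGroup H] [InnerProductSpace ℝ H]
  {φ : HilbertBasis ℕ ℝ H} {l : ℝ} {lam : ℕ → ℝ} {Φ : SobolevSpace φ l → ℝ} {K : ℝ≥0}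

theorem continuous_fderiv_apply (hK : LipschitzWith K (fderiv ℝ Φ)) :
    Continuous fun x : SobolevSpace φ l × SobolevSpace φ l => fderiv ℝ Φ x.1 x.2 :=
  (hK.continuous.comp continuous_fst).clm_apply continuous_snd

/-- The pairing `DΦ(q)(v)` is only locally Lipschitz; the linear growth of the constant is what
`exists_trapezoid_error_le` allows. -/
theorem abs_fderiv_apply_sub_le (hK : LipschitzWith K (fderiv ℝ Φ))
    (y z : SobolevSpace φ l × SobolevSpace φ l) :
    |fderiv ℝ Φ y.1 y.2 - fderiv ℝ Φ z.1 z.2|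
      ≤ (K + ‖fderiv ℝ Φ 0‖) * (1 + ‖y‖ + ‖z‖) * ‖y - z‖ := by
  have h1 : |(fderiv ℝ Φ y.1 - fderiv ℝ Φ z.1) y.2| ≤ K * ‖y - z‖ * ‖y‖ :=
    calc _ ≤ ‖fderiv ℝ Φ y.1 - fderiv ℝ Φ z.1‖ * ‖y.2‖ := ContinuousLinearMap.le_opNorm _ _
      _ ≤ K * ‖y - z‖ * ‖y‖ := by
        gcongr
        · refine (hK.norm_sub_le _ _).trans ?_
          gcongr
          exact norm_fst_le (y - z)
        · exact norm_snd_le y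
  have h2 : ‖fderiv ℝ Φ z.1‖ ≤ ‖fderiv ℝ Φ 0‖ + K * ‖z‖ := by
    have h3 := hK.norm_sub_le z.1 0
    have h4 := norm_add_le (fderiv ℝ Φ 0) (fderiv ℝ Φ z.1 - fderiv ℝ Φ 0)
    rw [add_sub_cancel] at h4
    rw [sub_zero] at h3
    have h5 : (K : ℝ) * ‖z.1‖ ≤ K * ‖z‖ := by gcongr; exact norm_fst_le z
    linarith
  have h3 : |fderiv ℝ Φ z.1 (y.2 - z.2)| ≤ (‖fderiv ℝ Φ 0‖ + K * ‖z‖) * ‖y - z‖ :=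
    calc _ ≤ ‖fderiv ℝ Φ z.1‖ * ‖y.2 - z.2‖ := ContinuousLinearMap.le_opNorm _ _
      _ ≤ _ := by
        gcongr
        exact norm_snd_le (y - z)
  have h4 : fderiv ℝ Φ y.1 y.2 - fderiv ℝ Φ z.1 z.2
      = (fderiv ℝ Φ y.1 - fderiv ℝ Φ z.1) y.2 + fderiv ℝ Φ z.1 (y.2 - z.2) := by
    rw [sub_apply, map_sub]
    ring
  rw [h4]
  refine (abs_add_le _ _).trans ((add_le_add h1 h3).trans ?_)
  have e1 : 0 ≤ ‖fderiv ℝ Φ 0‖ * ‖y‖ * ‖y - z‖ := by positivity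
  have e2 : 0 ≤ ‖fderiv ℝ Φ 0‖ * ‖z‖ * ‖y - z‖ := by positivity
  have e3 : 0 ≤ (K : ℝ) * ‖y - z‖ := by positivity
  linarith

variable [CompleteSpace (SobolevSpace φ l)]

theorem exists_lipschitzWith_applyC_fderiv
    (hS : Summable fun j : ℕ => ((j : ℝ) + 1) ^ (2 * l) * lam j ^ 2)
    (hK : LipschitzWith K (fderiv ℝ Φ)) :
    ∃ k, LipschitzWith k fun q => applyC lam (fderiv ℝ Φ q) := by
  set S : ℝ := ∑' j : ℕ, ((j : ℝ) + 1) ^ (2 * l) * lam j ^ 2 with hSdef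
  have hS0 : 0 ≤ S := tsum_nonneg fun j => by positivity
  refine ⟨S.toNNReal * K, LipschitzWith.of_dist_le_mul fun q q' => ?_⟩
  have h := norm_applyC_le hS (fderiv ℝ Φ q - fderiv ℝ Φ q')
  rw [← applyCL_apply hS, map_sub, applyCL_apply, applyCL_apply] at h
  rw [dist_eq_norm, dist_eq_norm, NNReal.coe_mul, Real.coe_toNNReal _ hS0, mul_assoc]
  refine h.trans ?_
  gcongr
  exact hK.norm_sub_le q q'

theorem continuous_sqNormSqrtC_fderiv
    (hS : Summable fun j : ℕ => ((j : ℝ) + 1) ^ (2 * l) * lam j ^ 2)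
    (hK : LipschitzWith K (fderiv ℝ Φ)) :
    Continuous fun q => sqNormSqrtC lam (fderiv ℝ Φ q) := by
  simp_rw [sqNormSqrtC_eq hS]
  exact hK.continuous.clm_apply (exists_lipschitzWith_applyC_fderiv hS hK).choose_spec.continuous

theorem lipschitzWith_hamiltonianField
    (hS : Summable fun j : ℕ => ((j : ℝ) + 1) ^ (2 * l) * lam j ^ 2)
    (hK : LipschitzWith K (fderiv ℝ Φ)) :
    ∃ K', LipschitzWith K' (hamiltonianField lam Φ) :=
  ⟨_, LipschitzWith.prod_snd.prodMk (LipschitzWith.prod_fst.neg.sub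
    ((exists_lipschitzWith_applyC_fderiv hS hK).choose_spec.comp LipschitzWith.prod_fst))⟩

/-- The splitting integrator is consistent of order one with the Hamiltonian system. -/
theorem exists_integratorStep_consistent
    (hS : Summable fun j : ℕ => ((j : ℝ) + 1) ^ (2 * l) * lam j ^ 2)
    (hK : LipschitzWith K (fderiv ℝ Φ)) :
    ∃ M : ℝ, 0 ≤ M ∧ ∀ h ∈ Set.Icc (0 : ℝ) 1, ∀ x : SobolevSpace φ l × SobolevSpace φ l,
      ‖integratorStep lam Φ h x - x - h • hamiltonianField lam Φ x‖ ≤ M * h ^ 2 * (1 + ‖x‖) := by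
  obtain ⟨k, hG⟩ := exists_lipschitzWith_applyC_fderiv hS hK
  set G : SobolevSpace φ l → SobolevSpace φ l := fun q => applyC lam (fderiv ℝ Φ q) with hGdef
  set m : ℝ := ‖G 0‖ + k with hm
  -- Here `m` bounds the growth of `G`, `2 + m` the position error, and `3 + m` the displacement `q₁
  -- - q`; the factor `k` converts that displacement into the difference of the two kicks.
  refine ⟨2 + m + k * (3 + m), by positivity, fun h hh x => ?_⟩
  obtain ⟨h0, h1⟩ := hh
  set n : ℝ := ‖x‖ with hn
  have hn0 : 0 ≤ n := norm_nonneg x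
  have hq : ‖x.1‖ ≤ n := norm_fst_le x
  have hv : ‖x.2‖ ≤ n := norm_snd_le x
  have hm0 : 0 ≤ m := by positivity
  have hk0 : (0 : ℝ) ≤ k := k.2
  have hGx : ‖G x.1‖ ≤ m * (1 + n) := by
    have e1 := hG.norm_sub_le x.1 0
    have e2 := norm_add_le (G 0) (G x.1 - G 0)
    rw [add_sub_cancel] at e2
    rw [sub_zero] at e1
    have e3 : (k : ℝ) * ‖x.1‖ ≤ k * n := by gcongr
    have e4 : 0 ≤ ‖G 0‖ * n := by positivity
    rw [hm]
    linarith
  have hcos : |Real.cos h - 1| ≤ h ^ 2 / 2 := by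
    rw [abs_le]
    constructor <;> linarith [Real.one_sub_sq_div_two_le_cos (x := h), Real.cos_le_one h,
      sq_nonneg h]
  have hsin : |Real.sin h| ≤ h := by
    rw [abs_of_nonneg (Real.sin_nonneg_of_nonneg_of_le_pi h0 (by linarith [Real.pi_gt_three]))]
    exact Real.sin_le h0
  have hsin' : |Real.sin h - h| ≤ h ^ 2 := by
    rcases h0.eq_or_lt with h' | h'
    · simp [← h']
    · rw [abs_le]
      have := Real.sin_gt_sub_cube h'
      constructor
      · nlinarith [sq_nonneg h]
      · nlinarith [Real.sin_le h0, sq_nonneg h]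
  set q₁ : SobolevSpace φ l := (integratorStep lam Φ h x).1 with hq₁
  have eq1 : q₁ - x.1 - h • x.2 = (Real.cos h - 1) • x.1 + (Real.sin h - h) • x.2
      - (h / 2 * Real.sin h) • G x.1 := by
    simp only [hq₁, integratorStep, flowA, flowB, hGdef]
    module
  have eq2 : (integratorStep lam Φ h x).2 - x.2 - h • (-x.1 - G x.1)
      = -(Real.sin h - h) • x.1 + (Real.cos h - 1) • x.2
        + (-(h / 2 * (Real.cos h - 1)) • G x.1 + (h / 2) • (G x.1 - G q₁)) := by
    simp only [hq₁, integratorStep, flowA, flowB, hGdef]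
    module
  have b1 : ‖q₁ - x.1 - h • x.2‖ ≤ (2 + m) * h ^ 2 * (1 + n) := by
    rw [eq1]
    calc _ ≤ ‖(Real.cos h - 1) • x.1‖ + ‖(Real.sin h - h) • x.2‖
          + ‖(h / 2 * Real.sin h) • G x.1‖ :=
          (norm_sub_le _ _).trans (by gcongr; exact norm_add_le _ _)
      _ ≤ h ^ 2 / 2 * n + h ^ 2 * n + h / 2 * h * (m * (1 + n)) := by
          simp only [norm_smul, Real.norm_eq_abs, abs_mul, abs_of_nonneg (by positivity : 0 ≤ h / 2)]
          gcongr
      _ ≤ _ := by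
          have : 0 ≤ h ^ 2 * n := by positivity
          have : 0 ≤ h ^ 2 * (m * (1 + n)) := by positivity
          nlinarith [sq_nonneg h]
  have b2 : ‖q₁ - x.1‖ ≤ (3 + m) * h * (1 + n) := by
    have e := norm_add_le (q₁ - x.1 - h • x.2) (h • x.2)
    rw [sub_add_cancel, norm_smul, Real.norm_of_nonneg h0] at e
    have e1 : h * ‖x.2‖ ≤ h * (1 + n) := by gcongr; linarith
    have e2 : (2 + m) * h ^ 2 * (1 + n) ≤ (2 + m) * h * (1 + n) := by
      gcongr
      nlinarith
    linarith
  have b3 : ‖(integratorStep lam Φ h x).2 - x.2 - h • (-x.1 - G x.1)‖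
      ≤ (2 + m + k * (3 + m)) * h ^ 2 * (1 + n) := by
    rw [eq2]
    have hGq : ‖G x.1 - G q₁‖ ≤ k * ((3 + m) * h * (1 + n)) := by
      rw [norm_sub_rev]
      exact (hG.norm_sub_le _ _).trans (by gcongr)
    calc _ ≤ ‖-(Real.sin h - h) • x.1‖ + ‖(Real.cos h - 1) • x.2‖
          + (‖-(h / 2 * (Real.cos h - 1)) • G x.1‖ + ‖(h / 2) • (G x.1 - G q₁)‖) :=
          (norm_add_le _ _).trans (add_le_add (norm_add_le _ _) (norm_add_le _ _))
      _ ≤ h ^ 2 * n + h ^ 2 / 2 * n + (h / 2 * (h ^ 2 / 2) * (m * (1 + n))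
          + h / 2 * (k * ((3 + m) * h * (1 + n)))) := by
          simp only [norm_smul, norm_neg, Real.norm_eq_abs, abs_mul,
            abs_of_nonneg (by positivity : 0 ≤ h / 2)]
          gcongr
      _ ≤ _ := by
          have e1 : 0 ≤ h ^ 2 * n := by positivity
          have e2 : h / 2 * (h ^ 2 / 2) * (m * (1 + n)) ≤ 1 * h ^ 2 * (m * (1 + n)) := by
            gcongr
            · linarith
            · linarith [sq_nonneg h]
          have e3 : 0 ≤ h ^ 2 * (k * ((3 + m) * (1 + n))) := by positivity
          nlinarith [sq_nonneg h]
  rw [Prod.norm_def]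
  refine max_le ?_ b3
  refine b1.trans ?_
  have e1 : 0 ≤ (k : ℝ) * (3 + m) * h ^ 2 * (1 + n) := by positivity
  linarith

end Regularity

/-! ### Transport of the Gaussian reference measure and of the target. -/

section Invariance

variable {H : Type*} [NormedAddCommGroup H] [InnerProductSpace ℝ H]
  {φ : HilbertBasis ℕ ℝ H} {l : ℝ} {lam : ℕ → ℝ} {Φ : SobolevSpace φ l → ℝ} {K : ℝ≥0}
  [CompleteSpace (SobolevSpace φ l)] [SecondCountableTopology (SobolevSpace φ l)]
  {γ : Measure (SobolevSpace φ l)} [IsGaussian γ]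

theorem preservesWith_flowA (hγ : ∫ f, f ∂γ = 0) (t : ℝ) :
    PreservesWith (γ.prod γ) (flowA t) 0 := by
  have h : (flowA t : SobolevSpace φ l × SobolevSpace φ l → _)
      = ContinuousLinearMap.rotation t := by
    ext x <;> simp [flowA, ContinuousLinearMap.rotation_apply]
  rw [h]
  exact .of_map_eq (by fun_prop) (IsGaussian.map_rotation_eq_self (by simpa using hγ) t)

/-- For frozen `q` the kick is a translation of `v` by `-t C DΦ(q)`, so Cameron–Martin applies
fibrewise. -/
theorem preservesWith_flowB (hγ : ∫ f, f ∂γ = 0)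
    (hcov : ∀ ξ η : StrongDual ℝ (SobolevSpace φ l), cov[ξ, η; γ] = η (applyC lam ξ))
    (hS : Summable fun j : ℕ => ((j : ℝ) + 1) ^ (2 * l) * lam j ^ 2)
    (hK : LipschitzWith K (fderiv ℝ Φ)) (t : ℝ) :
    PreservesWith (γ.prod γ) (flowB lam Φ t)
      (fun x => t * fderiv ℝ Φ x.1 x.2 - t ^ 2 / 2 * sqNormSqrtC lam (fderiv ℝ Φ x.1)) := by
  obtain ⟨k, hG⟩ := exists_lipschitzWith_applyC_fderiv hS hK
  have hm : Measurable (flowB lam Φ t) := by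
    have hGc := hG.continuous
    exact (continuous_fst.prodMk
      (continuous_snd.sub ((hGc.comp continuous_fst).const_smul t))).measurable
  have hw : Measurable fun x : SobolevSpace φ l × SobolevSpace φ l =>
      t * fderiv ℝ Φ x.1 x.2 - t ^ 2 / 2 * sqNormSqrtC lam (fderiv ℝ Φ x.1) := by
    have h1 := continuous_fderiv_apply hK
    have h2 := (continuous_sqNormSqrtC_fderiv hS hK).comp
      (continuous_fst (X := SobolevSpace φ l) (Y := SobolevSpace φ l))
    exact ((continuous_const.mul h1).sub (continuous_const.mul h2)).measurable
  refine ⟨hm, hw, fun f hf => ?_⟩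
  rw [lintegral_prod _ (by fun_prop), lintegral_prod _ hf.aemeasurable]
  refine lintegral_congr fun q => ?_
  have hc : ∀ η : StrongDual ℝ (SobolevSpace φ l),
      cov[⇑(t • fderiv ℝ Φ q), η; γ] = η (t • applyC lam (fderiv ℝ Φ q)) := fun η => by
    rw [hcov, ← applyCL_apply hS, map_smul, applyCL_apply]
  refine Eq.trans (lintegral_congr fun v => ?_) (lintegral_sub_mul_exp_dual hγ
    (t • fderiv ℝ Φ q) _ hc (hf.comp measurable_prodMk_left : Measurable fun v => f (q, v)))
  simp only [flowB, sqNormSqrtC_eq hS, smul_apply, map_smul, smul_eq_mul]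
  ring_nf

theorem preservesWith_integratorStep (hγ : ∫ f, f ∂γ = 0)
    (hcov : ∀ ξ η : StrongDual ℝ (SobolevSpace φ l), cov[ξ, η; γ] = η (applyC lam ξ))
    (hS : Summable fun j : ℕ => ((j : ℝ) + 1) ^ (2 * l) * lam j ^ 2)
    (hK : LipschitzWith K (fderiv ℝ Φ)) (h : ℝ) :
    PreservesWith (γ.prod γ) (integratorStep lam Φ h) (fun x => -stepError lam Φ h x) := by
  have hB := preservesWith_flowB hγ hcov hS hK (h / 2)
  have hcomp := (hB.comp (preservesWith_flowA hγ h)).comp hB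
  refine (funext fun x => ?_ : (fun x => -stepError lam Φ h x) = _) ▸ hcomp
  set y := flowA h (flowB lam Φ (h / 2) x)
  have e1 : (integratorStep lam Φ h x).1 = y.1 := rfl
  have e2 : (integratorStep lam Φ h x).2 = y.2 - (h / 2) • applyC lam (fderiv ℝ Φ y.1) := rfl
  simp only [stepError, e1, e2, Pi.zero_apply, zero_add, map_sub, map_smul, smul_eq_mul,
    ← sqNormSqrtC_eq hS]
  ring

theorem preservesWith_target_iterate (hγ : ∫ f, f ∂γ = 0)
    (hcov : ∀ ξ η : StrongDual ℝ (SobolevSpace φ l), cov[ξ, η; γ] = η (applyC lam ξ))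
    (hS : Summable fun j : ℕ => ((j : ℝ) + 1) ^ (2 * l) * lam j ^ 2) (hΦ : Differentiable ℝ Φ)
    (hK : LipschitzWith K (fderiv ℝ Φ)) (h : ℝ) (n : ℕ) :
    PreservesWith ((γ.prod γ).tilted fun x => -Φ x.1) (integratorStep lam Φ h)^[n + 1]
      (fun x => -energyError lam Φ h (n + 1) x) := by
  have hm : Measurable fun x : SobolevSpace φ l × SobolevSpace φ l => -Φ x.1 :=
    (hΦ.continuous.comp continuous_fst).neg.measurable
  convert ((preservesWith_integratorStep hγ hcov hS hK h).iterate (n + 1)).tilted hm using 1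
  ext x
  rw [energyError_eq_sum_stepError, Finset.sum_neg_distrib]
  ring

theorem map_velocityFlip_target (hγ : ∫ f, f ∂γ = 0) (hΦ : Differentiable ℝ Φ) :
    ((γ.prod γ).tilted fun x => -Φ x.1).map velocityFlip
      = (γ.prod γ).tilted fun x => -Φ x.1 := by
  have hγneg : γ.map (fun v => -v) = γ := by
    -- Rotation by `π` is `(q, v) ↦ (-q, -v)`; its second marginal gives the symmetry of `γ`.
    have hA := (preservesWith_flowA hγ Real.pi).lintegral_eq
    refine Measure.ext fun s hs => ?_
    have hs' : Measurable (s.indicator (1 : SobolevSpace φ l → ℝ≥0∞)) := measurable_one.indicator hs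
    have h1 := hA (fun x => s.indicator 1 x.2) (hs'.comp measurable_snd)
    simp only [flowA, Real.cos_pi, Real.sin_pi, zero_smul, neg_zero, zero_add, neg_smul, one_smul,
      Pi.zero_apply, Real.exp_zero, ENNReal.ofReal_one, mul_one] at h1
    rw [lintegral_prod _ (by fun_prop), lintegral_prod _ (by fun_prop)] at h1
    simp only [lintegral_const, measure_univ, mul_one] at h1
    rw [lintegral_indicator_one hs, ← lintegral_map hs' measurable_neg,
      lintegral_indicator_one hs] at h1
    exact h1
  have hm : Measurable fun x : SobolevSpace φ l × SobolevSpace φ l => -Φ x.1 :=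
    (hΦ.continuous.comp continuous_fst).neg.measurable
  have hflip : (γ.prod γ).map velocityFlip = γ.prod γ := by
    have h := Measure.map_prod_map γ γ measurable_id (measurable_neg (G := SobolevSpace φ l))
    rw [Measure.map_id] at h
    rw [show (fun v : SobolevSpace φ l => -v) = Neg.neg from rfl] at hγneg
    rw [hγneg] at h
    exact h.symm
  have hP := (PreservesWith.of_map_eq continuous_velocityFlip.measurable hflip).tilted hm
  refine Measure.ext fun s hs => ?_
  have h := hP.lintegral_eq (s.indicator 1) (measurable_one.indicator hs)
  simp only [velocityFlip, sub_self, Pi.zero_apply, add_zero, Real.exp_zero, ENNReal.ofReal_one,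
    mul_one] at h
  rw [← lintegral_indicator_one hs, ← lintegral_indicator_one hs,
    lintegral_map (measurable_one.indicator hs) continuous_velocityFlip.measurable]
  exact h

/-- Integrability of `exp (-Φ)` by Fernique's theorem. -/
theorem integrable_exp_neg_potential (hΦ : Differentiable ℝ Φ)
    (hlower : ∀ ε : ℝ, 0 < ε → ∃ K : ℝ, ∀ q : SobolevSpace φ l, K - ε * ‖q‖ ^ 2 ≤ Φ q) :
    Integrable (fun x : SobolevSpace φ l × SobolevSpace φ l => Real.exp (-Φ x.1)) (γ.prod γ) := by
  obtain ⟨c, hc, hint⟩ := IsGaussian.exists_integrable_exp_sq γ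
  -- The lower bound on `Φ` is used with `ε` equal to the Fernique exponent of `γ`.
  obtain ⟨k, hk⟩ := hlower c hc
  have h : Integrable (fun q => Real.exp (-Φ q)) γ := by
    refine (hint.const_mul (Real.exp (-k))).mono'
      (Real.continuous_exp.comp hΦ.continuous.neg).measurable.aestronglyMeasurable
      (.of_forall fun q => ?_)
    rw [Real.norm_of_nonneg (Real.exp_pos _).le, ← Real.exp_add]
    exact Real.exp_le_exp.2 (by linarith [hk q])
  exact h.comp_fst γ

/-- The exact flow preserves the target. -/
theorem map_flow_target (hγ : ∫ f, f ∂γ = 0)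
    (hcov : ∀ ξ η : StrongDual ℝ (SobolevSpace φ l), cov[ξ, η; γ] = η (applyC lam ξ))
    (hS : Summable fun j : ℕ => ((j : ℝ) + 1) ^ (2 * l) * lam j ^ 2) (hΦ : Differentiable ℝ Φ)
    (hK : LipschitzWith K (fderiv ℝ Φ))
    [IsProbabilityMeasure ((γ.prod γ).tilted fun x => -Φ x.1)]
    {K' : ℝ≥0} (hF : LipschitzWith K' (hamiltonianField lam Φ))
    {flow : ℝ → SobolevSpace φ l × SobolevSpace φ l → SobolevSpace φ l × SobolevSpace φ l}
    (hflow : IsExactFlow lam Φ flow) {T : ℝ} (hT : 0 < T) :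
    ((γ.prod γ).tilted fun x => -Φ x.1).map (flow T) = (γ.prod γ).tilted fun x => -Φ x.1 := by
  obtain ⟨M, hM0, hM⟩ := exists_integratorStep_consistent hS hK
  set h : ℕ → ℝ := fun n => T / ((n : ℝ) + 1) with hh
  have hlim0 : Tendsto h atTop (𝓝 0) := by
    have := (tendsto_one_div_add_atTop_nhds_zero_nat (𝕜 := ℝ)).const_mul T
    simpa [hh, div_eq_mul_inv] using this
  have hIcc : ∀ᶠ n in atTop, h n ∈ Set.Icc (0 : ℝ) 1 := by
    filter_upwards [hlim0.eventually_le_const one_pos] with n hn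
    exact ⟨by positivity, hn⟩
  have hnh : ∀ n : ℕ, ((n + 1 : ℕ) : ℝ) * h n = T := fun n => by
    push_cast
    rw [hh]
    field_simp
  have hpt : ∀ x, Tendsto (fun n => (integratorStep lam Φ (h n))^[n + 1] x) atTop
      (𝓝 (flow T x)) := fun x => by
    obtain ⟨C, hC0, hC⟩ := exists_scheme_error_le hF (hflow x).2 hM0 hM T
    rw [tendsto_iff_norm_sub_tendsto_zero]
    refine squeeze_zero' (.of_forall fun n => norm_nonneg _) ?_
      (by simpa using hlim0.const_mul C)
    filter_upwards [hIcc] with n hn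
    have := hC (h n) hn (n + 1) (hnh n).le
    rwa [hnh, (hflow x).1] at this
  refine map_eq_of_tendsto_preservesWith
    (continuous_flow hF hflow hT.le).measurable
    (fun n => preservesWith_target_iterate hγ hcov hS hΦ hK (h n) n) hpt fun x => ?_
  have hA : ∀ t, HasDerivAt (fun s => Φ (flow s x).1)
      (fderiv ℝ Φ (flow t x).1 (flow t x).2) t := fun t =>
    (hΦ _).hasFDerivAt.comp_hasDerivAt t
      (by simpa [hamiltonianField] using! ((hflow x).2 t).hasFDerivAt.fst.hasDerivAt)
  obtain ⟨C, hC0, hC⟩ := exists_trapezoid_error_le hF (hflow x).2 hM0 hM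
    (A := fun x => Φ x.1) (G := fun x => fderiv ℝ Φ x.1 x.2) hA (by positivity)
    (abs_fderiv_apply_sub_le hK) T
  -- `ΔH` is the sum of this trapezoidal error, the difference of `Φ` at the numerical and exact
  -- endpoints, and a term with prefactor `h²/8`; each tends to zero.
  have h1 : Tendsto (fun n => Φ (flow T x).1 - Φ x.1 - ∑ i ∈ Finset.range (n + 1), h n / 2 *
      (fderiv ℝ Φ ((integratorStep lam Φ (h n))^[i] x).1 ((integratorStep lam Φ (h n))^[i] x).2
        + fderiv ℝ Φ ((integratorStep lam Φ (h n))^[i + 1] x).1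
          ((integratorStep lam Φ (h n))^[i + 1] x).2)) atTop (𝓝 0) := by
    refine squeeze_zero_norm' ?_ (by simpa using hlim0.const_mul C)
    filter_upwards [hIcc] with n hn
    have := hC (h n) hn (n + 1) (hnh n).le
    rwa [hnh, (hflow x).1] at this
  have hfst := (continuous_fst.tendsto _).comp (hpt x)
  have h2 := ((hΦ.continuous.tendsto _).comp hfst).sub_const (Φ (flow T x).1)
  have h3 := (((continuous_sqNormSqrtC_fderiv hS hK).tendsto _).comp hfst).const_sub
    (sqNormSqrtC lam (fderiv ℝ Φ x.1))
  have h4 := ((hlim0.pow 2).div_const 8).mul h3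
  have h5 := ((h1.add h2).add h4).neg
  simp only [sub_self, zero_add, ne_eq, OfNat.ofNat_ne_zero, not_false_eq_true, zero_pow, zero_div,
    zero_mul, neg_zero] at h5
  refine h5.congr fun n => ?_
  rw [energyError_eq_trapezoid]
  simp only [Function.comp_apply]
  ring

end Invariance

/-- The decay of the standard deviations makes `∑ⱼ j^(2l) λⱼ²` finite. -/
theorem summable_of_limsup_lt_top {lam : ℕ → ℝ} (hlam : ∀ j, 0 < lam j) {κ l : ℝ}
    (hdecay_upper :
      limsup (fun j : ℕ => ((((j : ℝ) + 1) ^ κ * lam j : ℝ) : EReal)) atTop < ⊤)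
    (hl : l < κ - 1 / 2) :
    Summable fun j : ℕ => ((j : ℝ) + 1) ^ (2 * l) * lam j ^ 2 := by
  obtain ⟨c, hc, hc'⟩ := EReal.lt_iff_exists_real_btwn.1 hdecay_upper
  have hev := eventually_lt_of_limsup_lt hc
  have hsum : Summable fun j : ℕ => c ^ 2 * ((j : ℝ) + 1) ^ (2 * l - 2 * κ) := by
    -- The exponent is below `-1` precisely because `l < κ - 1/2`.
    have h := (Real.summable_nat_rpow (p := 2 * l - 2 * κ)).2 (by linarith)
    have h' := (summable_nat_add_iff 1).2 h
    refine (h'.mul_left (c ^ 2)).congr fun j => by push_cast; rfl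
  refine Summable.of_norm_bounded_eventually_nat hsum ?_
  filter_upwards [hev] with j hj
  have hj' : ((j : ℝ) + 1) ^ κ * lam j < c := by exact_mod_cast hj
  have hp : (0 : ℝ) < (j : ℝ) + 1 := by positivity
  have hlj := hlam j
  rw [Real.norm_of_nonneg (by positivity), Real.rpow_sub hp, mul_div_assoc',
    le_div_iff₀ (by positivity), SobolevSpace.weight_sq κ]
  calc ((j : ℝ) + 1) ^ (2 * l) * lam j ^ 2 * (((j : ℝ) + 1) ^ κ) ^ 2
      = (((j : ℝ) + 1) ^ κ * lam j) ^ 2 * ((j : ℝ) + 1) ^ (2 * l) := by ring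
    _ ≤ c ^ 2 * ((j : ℝ) + 1) ^ (2 * l) := by gcongr

end PHMC

end

/-! ### Assembly of the proposition. -/

theorem mainTheorem4 {H : Type*} [NormedAddCommGroup H] [InnerProductSpace ℝ H]
    [CompleteSpace H] [TopologicalSpace.SeparableSpace H] [MeasurableSpace H] [BorelSpace H]
    -- the centred Gaussian prior `N(0, C)`
    (π₀ : Measure H) [IsGaussian π₀] (hmean : ∫ x, x ∂π₀ = 0)
    -- an orthonormal eigenbasis of the covariance operator
    (φ : HilbertBasis ℕ ℝ H) (lam : ℕ → ℝ) (hlam : ∀ j, 0 < lam j)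
    (heig : ∀ j, covarianceOperator π₀ (φ j) = lam j ^ 2 • φ j)
    -- polynomial decay of the standard deviations
    (κ : ℝ) (hκ : 1 / 2 < κ)
    (hdecay_lower :
      0 < liminf (fun j : ℕ => ((((j : ℝ) + 1) ^ κ * lam j : ℝ) : EReal)) atTop)
    (hdecay_upper :
      limsup (fun j : ℕ => ((((j : ℝ) + 1) ^ κ * lam j : ℝ) : EReal)) atTop < ⊤)
    -- the potential
    (l : ℝ) (hl0 : 0 ≤ l) (hl : l < κ - 1 / 2)
    (Φ : PHMC.SobolevSpace φ l → ℝ) (hΦ : Differentiable ℝ Φ)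
    (hLip : ∃ L : ℝ, ∀ q q' : PHMC.SobolevSpace φ l,
      ‖fderiv ℝ Φ q - fderiv ℝ Φ q'‖ ≤ L * ‖q - q'‖)
    (hlower : ∀ ε : ℝ, 0 < ε → ∃ K : ℝ, ∀ q : PHMC.SobolevSpace φ l, K - ε * ‖q‖ ^ 2 ≤ Φ q) :
    IsProbabilityMeasure (PHMC.target π₀ Φ) ∧
    -- adjusted pHMC
    (∀ (T h : ℝ) (I : ℕ), 0 < T → 0 < h → T = I * h →
      ∃ p : Kernel (PHMC.SobolevSpace φ l × PHMC.SobolevSpace φ l)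
          (PHMC.SobolevSpace φ l × PHMC.SobolevSpace φ l),
        IsMarkovKernel p ∧
        (∀ x, p x = PHMC.transition ((PHMC.integratorStep lam Φ h)^[I])
          (PHMC.acceptProb lam Φ h I) x) ∧
        PHMC.IsGeneralizedReversible p (PHMC.target π₀ Φ) PHMC.velocityFlip) ∧
    -- exact pHMC
    (∃ flow, PHMC.IsExactFlow lam Φ flow ∧
      (∀ flow', PHMC.IsExactFlow lam Φ flow' → flow' = flow) ∧
      ∀ T : ℝ, 0 < T →
        ∃ p : Kernel (PHMC.SobolevSpace φ l × PHMC.SobolevSpace φ l)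
            (PHMC.SobolevSpace φ l × PHMC.SobolevSpace φ l),
          IsMarkovKernel p ∧
          (∀ x, p x = PHMC.transition (flow T) (fun _ => 1) x) ∧
          PHMC.IsGeneralizedReversible p (PHMC.target π₀ Φ) PHMC.velocityFlip) := by

  have hS := PHMC.summable_of_limsup_lt_top hlam hdecay_upper hl
  have := UniformSpace.secondCountable_of_separable H
  have := PHMC.SobolevSpace.completeSpace (φ := φ) hl0
  have := PHMC.SobolevSpace.secondCountableTopology (φ := φ) hl0
  obtain ⟨hG, hγ, hcov⟩ := PHMC.isGaussian_comap_toH (φ := φ) hmean hl0 heig hS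
  obtain ⟨L, hL⟩ := hLip
  have hK : LipschitzWith L.toNNReal (fderiv ℝ Φ) := LipschitzWith.of_dist_le_mul fun q q' => by
    rw [dist_eq_norm, dist_eq_norm]
    refine (hL q q').trans ?_
    gcongr
    exact Real.le_coe_toNNReal L
  have hprob : IsProbabilityMeasure (PHMC.target π₀ Φ) :=
    isProbabilityMeasure_tilted (PHMC.integrable_exp_neg_potential hΦ hlower)
  have hflipm : Measurable (PHMC.velocityFlip (φ := φ) (l := l)) :=
    PHMC.continuous_velocityFlip.measurable
  have hflip := PHMC.map_velocityFlip_target hγ hΦ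
  refine ⟨hprob, fun T h I hT _ hTI => ?_, ?_⟩
  -- `T > 0` excludes zero steps, for which the trapezoidal form of `ΔH` would fail.
  · obtain ⟨n, rfl⟩ : ∃ n, I = n + 1 := Nat.exists_eq_succ_of_ne_zero fun h0 => by
      simp [h0] at hTI
      linarith
    have hP := PHMC.preservesWith_target_iterate hγ hcov hS hΦ hK h n
    have hE : Measurable (PHMC.energyError lam Φ h (n + 1)) := by
      simpa only [Pi.neg_def, neg_neg] using hP.measurable_weight.neg
    obtain ⟨p, hpM, hp⟩ := PHMC.exists_kernel_of_measurable (α := PHMC.acceptProb lam Φ h (n + 1))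
      hflipm hP.measurable (by unfold PHMC.acceptProb; fun_prop)
      (fun x => le_min zero_le_one (Real.exp_pos _).le) (fun x => min_le_left _ _)
    exact ⟨p, hpM, hp, PHMC.isGeneralizedReversible_of_preservesWith
      PHMC.velocityFlip_involutive hflipm hflip
      (PHMC.involutive_comp_iterate PHMC.velocityFlip_involutive
        (PHMC.integratorStep_velocityFlip_integratorStep h) (n + 1))
      (PHMC.energyError_velocityFlip h n) hP p hp⟩
  · obtain ⟨K', hF⟩ := PHMC.lipschitzWith_hamiltonianField hS hK
    obtain ⟨flow, hflow⟩ := PHMC.exists_global_flow hF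
    refine ⟨flow, hflow, fun flow' hflow' => ?_, fun T hT => ?_⟩
    · ext1 t
      ext1 x
      exact congrFun (PHMC.eq_of_forall_hasDerivAt hF (t₀ := 0) (hflow' x).2 (hflow x).2
        ((hflow' x).1.trans (hflow x).1.symm)) t
    · have hm : Measurable (flow T) := (PHMC.continuous_flow hF hflow hT.le).measurable
      obtain ⟨p, hpM, hp⟩ := PHMC.exists_kernel_of_measurable (α := fun _ => 1)
        hflipm hm measurable_const (fun _ => zero_le_one) (fun _ => le_rfl)
      have hinv : (PHMC.target π₀ Φ).map (flow T) = PHMC.target π₀ Φ :=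
        have : IsProbabilityMeasure (((π₀.comap PHMC.SobolevSpace.toH).prod
          (π₀.comap PHMC.SobolevSpace.toH)).tilted fun x => -Φ x.1) := hprob
        PHMC.map_flow_target hγ hcov hS hΦ hK hF hflow hT
      -- With zero energy error the acceptance probability `min(1, e⁰)` is one and the weight is
      -- trivial.
      refine ⟨p, hpM, hp, PHMC.isGeneralizedReversible_of_preservesWith (D := 0)
        PHMC.velocityFlip_involutive hflipm hflip
        (PHMC.velocityFlip_flow_involutive hF hflow T) (by simp) ?_ p (by simpa using hp)⟩
      simpa using! PHMC.PreservesWith.of_map_eq hm hinv
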